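/- Let $\Bbbk$ be an algebraically closed field. Call a small $\Bbbk$-linear category \emph{finitary} if it is additive and idempotent complete, has finite dimensional morphism spaces, and has only finitely many isomorphism classes of indecomposable objects; let $\mathfrak{A}^f_{\Bbbk}$ be the $2$-category of finitary $\Bbbk$-linear categories, additive $\Bbbk$-linear functors and natural transformations. A (strict) $2$-category $\mathscr{C}$ is \emph{finitary} if it has finitely many objects up to equivalence, every category $\mathscr{C}(\mathtt{i},\mathtt{j})$ is a finitary $\Bbbk$-linear category, horizontal composition is additive and $\Bbbk$-linear, and every identity $1$-morphism $\mathbb{1}_{\mathtt{i}}$ is indecomposable. For a $2$-category $\mathscr{B}$, let $\mathscr{B}\text{-afmod}$ be the $2$-category whose objects are the homomorphisms (pseudofunctors) $\mathscr{B}\to\mathfrak{A}^f_{\Bbbk}$, whose $1$-morphisms are strong transformations and whose $2$-morphisms are modifications. A homomorphism of $2$-categories is a \emph{biequivalence} if every object of the target is equivalent to one in its image and it is an equivalence on all categories of morphisms. Let $\mathscr{C}$ be a finitary $2$-category. For objects $\mathtt{i},\mathtt{j}$ write $\mathtt{i}\preceq\mathtt{j}$ if there are $\Phi\in\mathscr{C}(\mathtt{j},\mathtt{i})$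 and $\Psi\in\mathscr{C}(\mathtt{i},\mathtt{j})$ with $\Phi\circ\Psi\cong\mathbb{1}_{\mathtt{i}}$. This is a preorder that is invariant under equivalence of objects; call $\mathtt{i}$ maximal if $\mathtt{i}\preceq\mathtt{j}$ implies $\mathtt{j}\preceq\mathtt{i}$. Let ${}^{\dagger}\mathscr{C}$ be the full $2$-subcategory of $\mathscr{C}$ given by any choice of exactly one object in each equivalence class of maximal objects. \textbf{Proposition.} The restriction homomorphism $$\mathrm{Res}:\mathscr{C}\text{-afmod}\longrightarrow{}^{\dagger}\mathscr{C}\text{-afmod}$$ is a biequivalence; in particular $\mathscr{C}\text{-afmod}$ and ${}^{\dagger}\mathscr{C}\text{-afmod}$ are biequivalent. The same holds for the restriction between the full $2$-subcategories of locally $\Bbbk$-linear $2$-representations, that is, of those homomorphisms $\mathbf{M}$ for which all functors $\mathbf{M}_{\mathtt{i},\mathtt{j}}$ on categories of morphisms are additive and $\Bbbk$-linear. -/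

import Mathlib

open CategoryTheory CategoryTheory.Limits CategoryTheory.Bicategory
open scoped CategoryTheory.Pseudofunctor.StrongTrans

universe w w₁ w₂ w₃ v v₁ v₂ v₃ u u₁ u₂ u₃

noncomputable section

namespace FinitaryMorita

/-! ### Finitary additive categories -/

/-- Indecomposable objects of a category with finite direct sums: nonzero objects that are not a
direct sum of two nonzero objects. -/
def IsIndecomposable {𝒜 : Type u} [Category.{v} 𝒜] [Preadditive 𝒜] [HasFiniteBiproducts 𝒜]
    (X : 𝒜) : Prop :=
  haveI := hasBinaryBiproducts_of_finite_biproducts 𝒜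
  Indecomposable X

/-- A `k`-linear category is finitary if it is additive, idempotent complete, has
finite dimensional morphism spaces, and has only finitely many isomorphism classes of
indecomposable objects. -/
class IsFinitaryCategory (k : Type w) [Field k] (𝒜 : Type u) [Category.{v} 𝒜] [Preadditive 𝒜]
    [Linear k 𝒜] : Prop extends HasFiniteBiproducts 𝒜, IsIdempotentComplete 𝒜 where
  finite_hom (X Y : 𝒜) : Module.Finite k (X ⟶ Y)
  finite_indecomposables : ∃ s : Set 𝒜, s.Finite ∧
    ∀ X : 𝒜, IsIndecomposable X → ∃ Y ∈ s, Nonempty (X ≅ Y)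

/-- A bundled finitary `k`-linear category: an object of `𝔄ᶠ_k`. -/
structure FinAddCat (k : Type w) [Field k] where
  carrier : Type u
  [category : Category.{v} carrier]
  [preadditive : Preadditive carrier]
  [linear : Linear k carrier]
  [finitary : IsFinitaryCategory k carrier]

attribute [instance] FinAddCat.category FinAddCat.preadditive FinAddCat.linear FinAddCat.finitary

/-- The property of a functor to be additive and `k`-linear. -/
def IsLinearFunctor (k : Type w) [Field k] (𝒜 : Type u) [Category.{v} 𝒜] [Preadditive 𝒜]
    [Linear k 𝒜] (ℬ : Type u₁) [Category.{v₁} ℬ] [Preadditive ℬ] [Linear k ℬ] :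
    ObjectProperty (𝒜 ⥤ ℬ) :=
  fun F => F.Additive ∧ F.Linear k

namespace FinAddCat

variable {k : Type w} [Field k]

/-- 1-morphisms of `𝔄ᶠ_k` are additive `k`-linear functors. -/
structure Hom (A B : FinAddCat.{w, v, u} k) where
  functor : A.carrier ⥤ B.carrier
  property : IsLinearFunctor k A.carrier B.carrier functor

@[simps id_functor comp_functor]
instance : CategoryStruct (FinAddCat.{w, v, u} k) where
  Hom A B := Hom A B
  id A := ⟨𝟭 A.carrier, inferInstance, inferInstance⟩
  comp F G := ⟨F.functor ⋙ G.functor,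
    haveI := F.property.1
    haveI := G.property.1
    inferInstance,
    haveI := F.property.2
    haveI := G.property.2
    inferInstance⟩

/-- 2-morphisms of `𝔄ᶠ_k` are all natural transformations. -/
@[ext]
structure Hom₂ {A B : FinAddCat.{w, v, u} k} (F G : A ⟶ B) where
  natTrans : F.functor ⟶ G.functor

@[simps id_natTrans comp_natTrans]
instance homCategory (A B : FinAddCat.{w, v, u} k) : Category (A ⟶ B) where
  Hom F G := Hom₂ F G
  id F := ⟨𝟙 F.functor⟩
  comp α β := ⟨α.natTrans ≫ β.natTrans⟩

@[ext]
theorem hom₂_ext {A B : FinAddCat.{w, v, u} k} {F G : A ⟶ B} {α β : F ⟶ G}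
    (h : ∀ X, α.natTrans.app X = β.natTrans.app X) : α = β :=
  Hom₂.ext (NatTrans.ext (funext h))

/-- 2-morphisms of `𝔄ᶠ_k` as natural transformations. -/
def homEquiv {A B : FinAddCat.{w, v, u} k} (F G : A ⟶ B) :
    (F ⟶ G) ≃ (F.functor ⟶ G.functor) :=
  ⟨fun α => α.natTrans, fun α => ⟨α⟩, fun _ => rfl, fun _ => rfl⟩

instance homPreadditive (A B : FinAddCat.{w, v, u} k) : Preadditive (A ⟶ B) where
  homGroup F G := (homEquiv F G).addCommGroup
  add_comp _ _ _ _ _ _ := Hom₂.ext (Preadditive.add_comp (C := _ ⥤ _) _ _ _ _ _ _)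
  comp_add _ _ _ _ _ _ := Hom₂.ext (Preadditive.comp_add (C := _ ⥤ _) _ _ _ _ _ _)

instance homLinear (A B : FinAddCat.{w, v, u} k) : Linear k (A ⟶ B) where
  homModule F G := (homEquiv F G).module k
  smul_comp _ _ _ _ _ _ := Hom₂.ext (Linear.smul_comp (C := _ ⥤ _) _ _ _ _ _ _)
  comp_smul _ _ _ _ _ _ := Hom₂.ext (Linear.comp_smul (C := _ ⥤ _) _ _ _ _ _ _)

/-- The 2-isomorphism given by a natural isomorphism. -/
@[simps]
def mkIso₂ {A B : FinAddCat.{w, v, u} k} {F G : A ⟶ B} (α : F.functor ≅ G.functor) : F ≅ G where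
  hom := ⟨α.hom⟩
  inv := ⟨α.inv⟩

/-- The 2-category `𝔄ᶠ_k`. -/
@[simps! whiskerLeft_natTrans whiskerRight_natTrans associator_hom_natTrans
  associator_inv_natTrans leftUnitor_hom_natTrans leftUnitor_inv_natTrans
  rightUnitor_hom_natTrans rightUnitor_inv_natTrans]
instance : Bicategory (FinAddCat.{w, v, u} k) where
  homCategory := homCategory
  whiskerLeft F G H α := Hom₂.mk (F := F ≫ G) (G := F ≫ H)
    (Functor.whiskerLeft F.functor α.natTrans)
  whiskerRight {_ _ _ F G} α H := Hom₂.mk (F := F ≫ H) (G := G ≫ H)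
    (Functor.whiskerRight α.natTrans H.functor)
  associator F G H := mkIso₂ (F := (F ≫ G) ≫ H) (G := F ≫ G ≫ H)
    (Functor.associator F.functor G.functor H.functor)
  leftUnitor {A _} F := mkIso₂ (F := 𝟙 A ≫ F) (G := F) (Functor.leftUnitor F.functor)
  rightUnitor {_ B} F := mkIso₂ (F := F ≫ 𝟙 B) (G := F) (Functor.rightUnitor F.functor)

instance : Bicategory.Strict (FinAddCat.{w, v, u} k) where
  id_comp _ := rfl
  comp_id _ := rfl
  assoc _ _ _ := rfl
  leftUnitor_eqToIso _ := by ext; rfl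
  rightUnitor_eqToIso _ := by ext; rfl
  associator_eqToIso _ _ _ := by ext; rfl

end FinAddCat

/-! ### Finitary 2-categories -/

/-- A 2-category with `k`-linear categories of morphisms is finitary if it has finitely many
objects up to equivalence, its categories of morphisms are finitary, horizontal composition is
additive and `k`-linear in each variable, and identity 1-morphisms are indecomposable. -/
class IsFinitaryTwoCategory (k : Type w) [Field k] (C : Type u) [Bicategory.{w₁, v} C]
    [∀ i j : C, Preadditive (i ⟶ j)] [∀ i j : C, Linear k (i ⟶ j)] : Prop where
  strict : Bicategory.Strict C
  finite_objects : ∃ s : Set C, s.Finite ∧ ∀ i : C, ∃ j ∈ s, Nonempty (i ≌ j)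
  finitary_hom (i j : C) : IsFinitaryCategory k (i ⟶ j)
  whiskerLeft_add {a b c : C} (F : a ⟶ b) {G H : b ⟶ c} (α β : G ⟶ H) :
    F ◁ (α + β) = F ◁ α + F ◁ β
  whiskerLeft_smul {a b c : C} (F : a ⟶ b) {G H : b ⟶ c} (r : k) (α : G ⟶ H) :
    F ◁ (r • α) = r • (F ◁ α)
  add_whiskerRight {a b c : C} {F G : a ⟶ b} (α β : F ⟶ G) (H : b ⟶ c) :
    (α + β) ▷ H = α ▷ H + β ▷ H
  smul_whiskerRight {a b c : C} {F G : a ⟶ b} (r : k) (α : F ⟶ G) (H : b ⟶ c) :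
    (r • α) ▷ H = r • (α ▷ H)
  indecomposable_id (i : C) : IsIndecomposable (𝟙 i)

/-! ### The essential 2-subcategory -/

section Essential

variable {C : Type u} [Bicategory.{w, v} C]

/-- The relation `i ⪯ j`: there are `Φ ∈ C(j, i)` and `Ψ ∈ C(i, j)` with `Φ ∘ Ψ ≅ 𝟙 i`. -/
def RetractLE (i j : C) : Prop :=
  ∃ (Φ : j ⟶ i) (Ψ : i ⟶ j), Nonempty (Ψ ≫ Φ ≅ 𝟙 i)

/-- Maximality with respect to the preorder `⪯`. -/
def IsRetractMaximal (i : C) : Prop :=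
  ∀ j : C, RetractLE i j → RetractLE j i

/-- `D` is a choice of exactly one object in each equivalence class of maximal objects. -/
structure IsEssentialChoice (D : Set C) : Prop where
  maximal : ∀ i ∈ D, IsRetractMaximal i
  exists_equiv : ∀ i : C, IsRetractMaximal i → ∃ j ∈ D, Nonempty (i ≌ j)
  eq_of_equiv : ∀ i ∈ D, ∀ j ∈ D, Nonempty (i ≌ j) → i = j

/-- The full 2-subcategory on a set of objects. -/
abbrev FullSub (D : Set C) : Type u :=
  InducedBicategory C (Subtype.val : D → C)

/-- The inclusion of a full 2-subcategory. -/
abbrev FullSub.incl (D : Set C) : FullSub D ⥤ᵖ C :=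
  (InducedBicategory.forget (C := C) (F := (Subtype.val : D → C))).toPseudofunctor

instance FullSub.homPreadditive [∀ i j : C, Preadditive (i ⟶ j)] (D : Set C) (i j : FullSub D) :
    Preadditive (i ⟶ j) where
  homGroup F G := Equiv.addCommGroup (β := F.hom ⟶ G.hom)
    ⟨fun α => α.hom, fun α => ⟨α⟩, fun _ => rfl, fun _ => rfl⟩
  add_comp _ _ _ _ _ _ := InducedBicategory.hom₂_ext (Preadditive.add_comp _ _ _ _ _ _)
  comp_add _ _ _ _ _ _ := InducedBicategory.hom₂_ext (Preadditive.comp_add _ _ _ _ _ _)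

instance FullSub.homLinear (k : Type w₁) [Field k] [∀ i j : C, Preadditive (i ⟶ j)]
    [∀ i j : C, Linear k (i ⟶ j)] (D : Set C) (i j : FullSub D) : Linear k (i ⟶ j) where
  homModule F G :=
    let e : (F ⟶ G) ≃ (F.hom ⟶ G.hom) :=
      ⟨fun α => α.hom, fun α => ⟨α⟩, fun _ => rfl, fun _ => rfl⟩
    e.module k
  smul_comp _ _ _ _ _ _ := InducedBicategory.hom₂_ext (Linear.smul_comp (C := _ ⟶ _) _ _ _ _ _ _)
  comp_smul _ _ _ _ _ _ := InducedBicategory.hom₂_ext (Linear.comp_smul (C := _ ⟶ _) _ _ _ _ _ _)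

end Essential

/-! ### Biequivalences and precomposition -/

/-- A homomorphism is a biequivalence if it is essentially surjective on objects (up to
equivalence) and a local equivalence. -/
structure IsBiequivalence {A : Type u} [Bicategory.{w, v} A] {B : Type u₁} [Bicategory.{w₁, v₁} B]
    (H : A ⥤ᵖ B) : Prop where
  essSurj : ∀ b : B, ∃ a : A, Nonempty (H.obj a ≌ b)
  localEquiv : ∀ a a' : A, (H.mapFunctor a a').IsEquivalence

section Precomp

variable {D : Type u} [Bicategory.{w, v} D] {C : Type u₁} [Bicategory.{w₁, v₁} C]

variable {E : Type u₂} [Bicategory.{w₂, v₂} E]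

/-- Precomposition of a strong transformation with a homomorphism. -/
def precompTrans (J : D ⥤ᵖ C) {M N : C ⥤ᵖ E} (Λ : M ⟶ N) : J.comp M ⟶ J.comp N where
  app i := Λ.app (J.obj i)
  naturality F := Λ.naturality (J.map F)
  naturality_naturality α := Λ.naturality_naturality (J.map₂ α)
  naturality_id a := by
    change (Λ.naturality (J.map (𝟙 a))).hom ≫
        Λ.app (J.obj a) ◁ (N.map₂ (J.mapId a).hom ≫ (N.mapId (J.obj a)).hom) =
      (M.map₂ (J.mapId a).hom ≫ (M.mapId (J.obj a)).hom) ▷ Λ.app (J.obj a) ≫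
        (λ_ (Λ.app (J.obj a))).hom ≫ (ρ_ (Λ.app (J.obj a))).inv
    rw [Bicategory.whiskerLeft_comp, ← Λ.naturality_naturality_assoc, Λ.naturality_id,
      comp_whiskerRight, Category.assoc]
  naturality_comp {a b c} f g := by
    change (Λ.naturality (J.map (f ≫ g))).hom ≫ Λ.app (J.obj a) ◁
        (N.map₂ (J.mapComp f g).hom ≫ (N.mapComp (J.map f) (J.map g)).hom) =
      (M.map₂ (J.mapComp f g).hom ≫ (M.mapComp (J.map f) (J.map g)).hom) ▷ Λ.app (J.obj c) ≫
        (α_ _ _ _).hom ≫ M.map (J.map f) ◁ (Λ.naturality (J.map g)).hom ≫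
        (α_ _ _ _).inv ≫ (Λ.naturality (J.map f)).hom ▷ N.map (J.map g) ≫ (α_ _ _ _).hom
    rw [Bicategory.whiskerLeft_comp, ← Λ.naturality_naturality_assoc, Λ.naturality_comp,
      comp_whiskerRight, Category.assoc]

/-- Precomposition of a modification with a homomorphism. -/
def precompMod (J : D ⥤ᵖ C) {M N : C ⥤ᵖ E} {Λ Θ : M ⟶ N} (Γ : Λ ⟶ Θ) :
    precompTrans J Λ ⟶ precompTrans J Θ :=
  ⟨{ app := fun i => Γ.as.app (J.obj i)
     naturality := fun F => Γ.as.naturality (J.map F) }⟩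

/-- Precomposition is compatible with identity transformations. -/
def precompId (J : D ⥤ᵖ C) (M : C ⥤ᵖ E) : precompTrans J (𝟙 M) ≅ 𝟙 (J.comp M) :=
  Pseudofunctor.StrongTrans.isoMk (fun i => Iso.refl (𝟙 (M.obj (J.obj i)))) (by
    intro a b f
    change M.map (J.map f) ◁ 𝟙 (𝟙 (M.obj (J.obj b))) ≫
        (ρ_ (M.map (J.map f))).hom ≫ (λ_ (M.map (J.map f))).inv =
      ((ρ_ (M.map (J.map f))).hom ≫ (λ_ (M.map (J.map f))).inv) ≫
        𝟙 (𝟙 (M.obj (J.obj a))) ▷ M.map (J.map f)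
    simp)

/-- Precomposition is compatible with composition of transformations. -/
def precompComp (J : D ⥤ᵖ C) {M N P : C ⥤ᵖ E} (Λ : M ⟶ N) (Θ : N ⟶ P) :
    precompTrans J (Λ ≫ Θ) ≅ precompTrans J Λ ≫ precompTrans J Θ :=
  Pseudofunctor.StrongTrans.isoMk (fun i => Iso.refl (Λ.app (J.obj i) ≫ Θ.app (J.obj i))) (by
    intro a b f
    change M.map (J.map f) ◁ 𝟙 (Λ.app (J.obj b) ≫ Θ.app (J.obj b)) ≫
        ((Λ ≫ Θ).naturality (J.map f)).hom =
      ((Λ ≫ Θ).naturality (J.map f)).hom ≫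
        𝟙 (Λ.app (J.obj a) ≫ Θ.app (J.obj a)) ▷ P.map (J.map f)
    rw [Bicategory.whiskerLeft_id, id_whiskerRight]
    exact (Category.id_comp _).trans (Category.comp_id _).symm)

variable (E) in
/-- Precomposition with a homomorphism `J : D ⥤ᵖ C`, as a homomorphism between the 2-categories of
homomorphisms, strong transformations and modifications. -/
def precomp (J : D ⥤ᵖ C) : (C ⥤ᵖ E) ⥤ᵖ (D ⥤ᵖ E) where
  obj M := J.comp M
  map Λ := precompTrans J Λ
  map₂ Γ := precompMod J Γ
  map₂_id _ := rfl
  map₂_comp _ _ := rfl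
  mapId M := precompId J M
  mapComp Λ Θ := precompComp J Λ Θ
  map₂_whisker_left {M N P} Λ Θ Θ' Γ := by
    ext i
    change Λ.app (J.obj i) ◁ Γ.as.app (J.obj i) =
      𝟙 _ ≫ Λ.app (J.obj i) ◁ Γ.as.app (J.obj i) ≫ 𝟙 _
    simp
  map₂_whisker_right {M N P} Λ Λ' Γ Θ := by
    ext i
    change Γ.as.app (J.obj i) ▷ Θ.app (J.obj i) =
      𝟙 _ ≫ Γ.as.app (J.obj i) ▷ Θ.app (J.obj i) ≫ 𝟙 _
    simp
  map₂_associator Λ Θ Ξ := by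
    ext i
    change (α_ (Λ.app (J.obj i)) (Θ.app (J.obj i)) (Ξ.app (J.obj i))).hom =
      𝟙 _ ≫ 𝟙 (Λ.app (J.obj i) ≫ Θ.app (J.obj i)) ▷ Ξ.app (J.obj i) ≫
        (α_ (Λ.app (J.obj i)) (Θ.app (J.obj i)) (Ξ.app (J.obj i))).hom ≫
        Λ.app (J.obj i) ◁ 𝟙 (Θ.app (J.obj i) ≫ Ξ.app (J.obj i)) ≫ 𝟙 _
    simp
  map₂_left_unitor {M N} Λ := by
    ext i
    change (λ_ (Λ.app (J.obj i))).hom =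
      𝟙 _ ≫ 𝟙 (𝟙 (M.obj (J.obj i))) ▷ Λ.app (J.obj i) ≫ (λ_ (Λ.app (J.obj i))).hom
    simp
  map₂_right_unitor {M N} Λ := by
    ext i
    change (ρ_ (Λ.app (J.obj i))).hom =
      𝟙 _ ≫ Λ.app (J.obj i) ◁ 𝟙 (𝟙 (N.obj (J.obj i))) ≫ (ρ_ (Λ.app (J.obj i))).hom
    simp

end Precomp

/-- The restriction of a homomorphism to full 2-subcategories. -/
def restrictFull {A : Type u} [Bicategory.{w, v} A] {B : Type u₁} [Bicategory.{w₁, v₁} B]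
    (H : A ⥤ᵖ B) (P : Set A) (Q : Set B) (h : ∀ a ∈ P, H.obj a ∈ Q) :
    FullSub P ⥤ᵖ FullSub Q where
  obj a := (⟨H.obj a.1, h a.1 a.2⟩ : Q)
  map F := InducedBicategory.mkHom (H.map F.hom)
  map₂ α := ⟨H.map₂ α.hom⟩
  map₂_id F := InducedBicategory.hom₂_ext (H.map₂_id F.hom)
  map₂_comp α β := InducedBicategory.hom₂_ext (H.map₂_comp α.hom β.hom)
  mapId a := InducedBicategory.isoMk (H.mapId a.1)
  mapComp F G := InducedBicategory.isoMk (H.mapComp F.hom G.hom)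
  map₂_whisker_left F _ _ α := InducedBicategory.hom₂_ext (H.map₂_whisker_left F.hom α.hom)
  map₂_whisker_right α G := InducedBicategory.hom₂_ext (H.map₂_whisker_right α.hom G.hom)
  map₂_associator F G K := InducedBicategory.hom₂_ext (H.map₂_associator F.hom G.hom K.hom)
  map₂_left_unitor F := InducedBicategory.hom₂_ext (H.map₂_left_unitor F.hom)
  map₂_right_unitor F := InducedBicategory.hom₂_ext (H.map₂_right_unitor F.hom)

/-! ### 2-representations -/

/-- The 2-category `C`-afmod of finitary 2-representations of `C`: homomorphisms from `C` to
`𝔄ᶠ_k`, strong transformations and modifications. -/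
abbrev Afmod (k : Type w) [Field k] (C : Type u) [Bicategory.{w₁, v} C] :=
  C ⥤ᵖ FinAddCat.{w, v₂, u₂} k

/-- The locally `k`-linear finitary 2-representations: those for which all the functors
`C(i, j) → 𝔄ᶠ_k(M(i), M(j))` are additive and `k`-linear. -/
def linearReps (k : Type w) [Field k] (C : Type u) [Bicategory.{w₁, v} C]
    [∀ i j : C, Preadditive (i ⟶ j)] [∀ i j : C, Linear k (i ⟶ j)] :
    Set (Afmod.{w, w₁, v, v₂, u, u₂} k C) :=
  {M | ∀ i j : C, IsLinearFunctor k (i ⟶ j) (M.obj i ⟶ M.obj j) (M.mapFunctor i j)}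

/-- The 2-category of locally `k`-linear finitary 2-representations, a full 2-subcategory of
`C`-afmod. -/
abbrev LinearAfmod (k : Type w) [Field k] (C : Type u) [Bicategory.{w₁, v} C]
    [∀ i j : C, Preadditive (i ⟶ j)] [∀ i j : C, Linear k (i ⟶ j)] :=
  FullSub (linearReps.{w, w₁, v, v₂, u, u₂} k C)

/-- Restriction of 2-representations from `C` to a full 2-subcategory. -/
def res (k : Type w) [Field k] {C : Type u} [Bicategory.{w₁, v} C] (D : Set C) :
    Afmod.{w, w₁, v, v₂, u, u₂} k C ⥤ᵖ Afmod.{w, w₁, v, v₂, u, u₂} k (FullSub D) :=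
  precomp (FinAddCat.{w, v₂, u₂} k) (FullSub.incl D)

theorem res_mem_linearReps (k : Type w) [Field k] {C : Type u} [Bicategory.{w₁, v} C]
    [∀ i j : C, Preadditive (i ⟶ j)] [∀ i j : C, Linear k (i ⟶ j)] (D : Set C)
    (M : Afmod.{w, w₁, v, v₂, u, u₂} k C) (hM : M ∈ linearReps k C) :
    (res k D).obj M ∈ linearReps k (FullSub D) := by
  intro i j
  exact ⟨⟨fun {_ _ α β} => (hM i.1 j.1).1.map_add⟩,
    ⟨fun α r => (hM i.1 j.1).2.map_smul α.hom r⟩⟩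

/-- Restriction of locally `k`-linear 2-representations from `C` to a full 2-subcategory. -/
def linearRes (k : Type w) [Field k] {C : Type u} [Bicategory.{w₁, v} C]
    [∀ i j : C, Preadditive (i ⟶ j)] [∀ i j : C, Linear k (i ⟶ j)] (D : Set C) :
    LinearAfmod.{w, w₁, v, v₂, u, u₂} k C ⥤ᵖ LinearAfmod.{w, w₁, v, v₂, u, u₂} k (FullSub D) :=
  restrictFull (res k D) _ _ (res_mem_linearReps k D)

end FinitaryMorita

end

/-!
Let `D` be a full sub-bicategory of `C` such that every object of `C` is a retract of one in `D`. A
homomorphism `M` on `D` extends to `C` by right Kan extension: its value at `i` is the category of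
families, the transformations into `M` from the restriction to `D` of the homomorphism corepresented
by `i`. At an object of `D`, evaluating a family at the identity is an equivalence, which is the
bicategorical Yoneda lemma. If `i` is a retract of `l ∈ D`, then a family on `i` is the pullback
along the projection `l ⟶ i` of the family generated by its value at the inclusion `i ⟶ l`. This
presents the category of families on `i` as a retract of `M l`, so that it is again finitary; it
shows that the extension is locally linear when `M` is; and it makes the unit, from a homomorphism
on `C` to the extension of its restriction, an equivalence. Hence restriction is an equivalence on
categories of morphisms by the two-out-of-six property, applied to restriction, transposition, and
restriction followed by evaluation at identities.

A maximal object above a given one exists because there are finitely many objects up to equivalence.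
-/

universe a₁ a₂ a₃ b₁ b₂ b₃

noncomputable section

namespace FinitaryMorita

/-! ### Equivalences -/

section Equivalences

variable {𝒜 : Type a₁} [Category.{b₁} 𝒜] {ℬ : Type a₂} [Category.{b₂} ℬ] {𝒳 : Type a₃}
  [Category.{b₃} 𝒳] {𝒴 : Type u₁} [Category.{v₁} 𝒴]

theorem isEquivalence_of_left_right_inverse {F : 𝒜 ⥤ ℬ} {L R : ℬ ⥤ 𝒜} (hL : L ⋙ F ≅ 𝟭 ℬ)
    (hR : F ⋙ R ≅ 𝟭 𝒜) : F.IsEquivalence :=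
  (CategoryTheory.Equivalence.mk F L
    (hR.symm ≪≫ Functor.isoWhiskerLeft F ((Functor.leftUnitor R).symm ≪≫
      Functor.isoWhiskerRight hL.symm R ≪≫ Functor.associator L F R ≪≫
      Functor.isoWhiskerLeft L hR ≪≫ Functor.rightUnitor L)) hL).isEquivalence_functor

theorem isEquivalence_of_two_out_of_six (F : 𝒜 ⥤ ℬ) (G : ℬ ⥤ 𝒳) (H : 𝒳 ⥤ 𝒴)
    [(F ⋙ G).IsEquivalence] [(G ⋙ H).IsEquivalence] : F.IsEquivalence :=
  have : G.IsEquivalence := isEquivalence_of_left_right_inverse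
    (L := (F ⋙ G).inv ⋙ F) (R := H ⋙ (G ⋙ H).inv)
    (F ⋙ G).asEquivalence.counitIso (G ⋙ H).asEquivalence.unitIso.symm
  Functor.isEquivalence_of_comp_right F G

theorem isEquivalence_of_essImage {U : 𝒜 ⥤ 𝒳} {V : ℬ ⥤ 𝒴} {H : 𝒜 ⥤ ℬ} {H' : 𝒳 ⥤ 𝒴} [U.Full]
    [U.Faithful] [V.Full] [V.Faithful] [hH' : H'.IsEquivalence] (e : H ⋙ V ≅ U ⋙ H')
    (h : ∀ X, V.essImage (H'.obj X) → U.essImage X) : H.IsEquivalence where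
  faithful := Functor.Faithful.of_comp_iso e
  full := Functor.Full.of_comp_faithful_iso e
  essSurj :=
    ⟨fun b =>
      have i := H'.objObjPreimageIso (V.obj b)
      have ⟨a, ⟨j⟩⟩ := h _ ⟨b, ⟨i.symm⟩⟩
      ⟨a, ⟨V.preimageIso (e.app a ≪≫ H'.mapIso j ≪≫ i)⟩⟩⟩

end Equivalences

section Postcomposition

variable {B : Type u} [Bicategory.{w, v} B] {a b : B}

theorem nonempty_equivalence_of_isEquivalence_postcomp (f : a ⟶ b)
    [(Bicategory.postcomp a f).IsEquivalence] [(Bicategory.postcomp b f).IsEquivalence] :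
    Nonempty (a ≌ b) :=
  let g := (Bicategory.postcomp b f).objPreimage (𝟙 b)
  let counit : g ≫ f ≅ 𝟙 b := (Bicategory.postcomp b f).objObjPreimageIso (𝟙 b)
  let unit : (Bicategory.postcomp a f).obj (𝟙 a) ≅ (Bicategory.postcomp a f).obj (f ≫ g) :=
    λ_ f ≪≫ (ρ_ f).symm ≪≫ whiskerLeftIso f counit.symm ≪≫ (α_ f g f).symm
  ⟨Bicategory.Equivalence.mkOfAdjointifyCounit ((Bicategory.postcomp a f).preimageIso unit) counit⟩

end Postcomposition

/-! ### Finitary categories -/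

section LinearFunctors

variable {k : Type w} [Field k] {𝒜 : Type u} [Category.{v} 𝒜] [Preadditive 𝒜] [Linear k 𝒜]
  {ℬ : Type u₁} [Category.{v₁} ℬ] [Preadditive ℬ] [Linear k ℬ]
  {𝒳 : Type u₂} [Category.{v₂} 𝒳] [Preadditive 𝒳] [Linear k 𝒳]

namespace IsLinearFunctor

theorem comp {F : 𝒜 ⥤ ℬ} {G : ℬ ⥤ 𝒳} (hF : IsLinearFunctor k _ _ F)
    (hG : IsLinearFunctor k _ _ G) : IsLinearFunctor k _ _ (F ⋙ G) :=
  have := hF.1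
  have := hF.2
  have := hG.1
  have := hG.2
  ⟨inferInstance, inferInstance⟩

theorem of_iso {F G : 𝒜 ⥤ ℬ} (hF : IsLinearFunctor k _ _ F) (e : F ≅ G) :
    IsLinearFunctor k _ _ G :=
  have := hF.1
  have := hF.2
  ⟨Functor.additive_of_iso e, Functor.linear_of_iso k e⟩

theorem inverse {e : 𝒜 ≌ ℬ} (he : IsLinearFunctor k _ _ e.functor) :
    IsLinearFunctor k _ _ e.inverse :=
  have := he.1
  have := he.2
  ⟨e.inverse_additive, Equivalence.inverseLinear k e⟩

end IsLinearFunctor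

end LinearFunctors

section Finitary

variable {k : Type w} [Field k] {𝒜 : Type u} [Category.{v} 𝒜] [Preadditive 𝒜]
  {ℬ : Type u₁} [Category.{v₁} ℬ] [Preadditive ℬ]

theorem IsIndecomposable.of_iso [HasFiniteBiproducts 𝒜] {X Y : 𝒜} (h : IsIndecomposable X)
    (e : X ≅ Y) : IsIndecomposable Y :=
  haveI := hasBinaryBiproducts_of_finite_biproducts 𝒜
  ⟨fun hY => h.1 (hY.of_iso e), fun Z W f => h.2 Z W (e ≪≫ f)⟩

theorem exists_iso_biprod_of_not_isIndecomposable [HasFiniteBiproducts 𝒜]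
    [HasBinaryBiproducts 𝒜] {X : 𝒜} (hX : ¬ IsIndecomposable X) (hX₀ : ¬ IsZero X) :
    ∃ Y Z : 𝒜, ¬ IsZero Y ∧ ¬ IsZero Z ∧ Nonempty (X ≅ Y ⊞ Z) := by
  by_contra! h
  exact hX ⟨hX₀, fun Y Z e => or_iff_not_imp_left.2 fun hY => by_contra fun hZ =>
    (h Y Z hY hZ).false e⟩

section FiniteDimensional

variable [Linear k 𝒜] [HasBinaryBiproducts 𝒜]

variable (k) in
/-- `biprod.map` as a linear map on pairs of endomorphisms. -/
@[simps]
def biprodMapLinearMap (Y Z : 𝒜) : (Y ⟶ Y) × (Z ⟶ Z) →ₗ[k] (Y ⊞ Z ⟶ Y ⊞ Z) where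
  toFun f := biprod.map f.1 f.2
  map_add' f g := by ext <;> simp
  map_smul' r f := by ext <;> simp

theorem biprodMapLinearMap_injective (Y Z : 𝒜) :
    Function.Injective (biprodMapLinearMap k Y Z) := fun f g h => by
  have h₁ := congr(biprod.inl ≫ $h ≫ biprod.fst)
  have h₂ := congr(biprod.inr ≫ $h ≫ biprod.snd)
  exact Prod.ext (by simpa using h₁) (by simpa using h₂)

theorem finrank_hom_self_lt_of_iso_biprod [∀ X Y : 𝒜, Module.Finite k (X ⟶ Y)] {X Y Z : 𝒜}
    (e : X ≅ Y ⊞ Z) (hZ : ¬ IsZero Z) :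
    Module.finrank k (Y ⟶ Y) < Module.finrank k (X ⟶ X) := by
  have hpos : 0 < Module.finrank k (Z ⟶ Z) :=
    Module.finrank_pos_iff.2 ⟨𝟙 Z, 0, fun h => hZ ((IsZero.iff_id_eq_zero Z).2 h)⟩
  have hle := LinearMap.finrank_le_finrank_of_injective (biprodMapLinearMap_injective (k := k) Y Z)
  rw [Module.finrank_prod, ← (Linear.homCongr k e e).finrank_eq] at hle
  lia

end FiniteDimensional

/-- An object whose image is indecomposable has an indecomposable direct summand with the same
image: split off direct summands with zero image until none is left. -/
theorem exists_isIndecomposable_of_isIndecomposable_obj [Linear k 𝒜] [HasFiniteBiproducts 𝒜]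
    [HasFiniteBiproducts ℬ] [∀ X Y : 𝒜, Module.Finite k (X ⟶ Y)] (p : 𝒜 ⥤ ℬ) [p.Additive] (X : 𝒜)
    (h : IsIndecomposable (p.obj X)) :
    ∃ Y : 𝒜, IsIndecomposable Y ∧ Nonempty (p.obj X ≅ p.obj Y) := by
  have := hasBinaryBiproducts_of_finite_biproducts 𝒜
  have := hasBinaryBiproducts_of_finite_biproducts ℬ
  have := preservesBinaryBiproducts_of_preservesBiproducts p
  induction hn : Module.finrank k (X ⟶ X) using Nat.strong_induction_on generalizing X with
  | _ n ih =>
    have of_summand {Y Z : 𝒜} (e : X ≅ Y ⊞ Z) (hZ : ¬ IsZero Z) (hpZ : IsZero (p.obj Z)) :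
        ∃ W : 𝒜, IsIndecomposable W ∧ Nonempty (p.obj X ≅ p.obj W) := by
      have f : p.obj X ≅ p.obj Y := p.mapIso e ≪≫ p.mapBiprod Y Z ≪≫ (isoBiprodZero hpZ).symm
      obtain ⟨W, hW, ⟨g⟩⟩ :=
        ih _ (hn ▸ finrank_hom_self_lt_of_iso_biprod e hZ) Y (h.of_iso f) rfl
      exact ⟨W, hW, ⟨f ≪≫ g⟩⟩
    by_cases hX : IsIndecomposable X
    · exact ⟨X, hX, ⟨Iso.refl _⟩⟩
    obtain ⟨Y, Z, hY, hZ, ⟨e⟩⟩ :=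
      exists_iso_biprod_of_not_isIndecomposable hX fun h₀ => h.1 (p.map_isZero h₀)
    rcases h.2 _ _ (p.mapIso e ≪≫ p.mapBiprod Y Z) with hpY | hpZ
    · exact of_summand (e ≪≫ biprod.braiding Y Z) hY hpY
    · exact of_summand e hZ hpZ

theorem isIdempotentComplete_of_retract {𝒳 : Type u₂} [Category.{v₂} 𝒳] {𝒴 : Type u₃}
    [Category.{v₃} 𝒴] [IsIdempotentComplete 𝒳] {s : 𝒴 ⥤ 𝒳} {p : 𝒳 ⥤ 𝒴} (e : s ⋙ p ≅ 𝟭 𝒴) :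
    IsIdempotentComplete 𝒴 where
  idempotents_split Y f hf := by
    obtain ⟨Z, i, r, hir, hri⟩ := IsIdempotentComplete.idempotents_split (s.obj Y) (s.map f)
      (by rw [← s.map_comp, hf])
    refine ⟨p.obj Z, p.map i ≫ e.hom.app Y, e.inv.app Y ≫ p.map r, ?_, ?_⟩
    · have h := e.hom_inv_id_app_assoc Y (p.map r)
      dsimp only [Functor.comp_obj] at h
      rw [Category.assoc, h, ← p.map_comp, hir, p.map_id]
    · rw [Category.assoc, ← p.map_comp_assoc, hri]
      exact NatIso.naturality_1 e f

theorem IsFinitaryCategory.of_retract [Linear k 𝒜] [Linear k ℬ] [IsFinitaryCategory k 𝒜]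
    {s : ℬ ⥤ 𝒜} {p : 𝒜 ⥤ ℬ} [s.Additive] [s.Linear k] [p.Additive] (e : s ⋙ p ≅ 𝟭 ℬ) :
    IsFinitaryCategory k ℬ := by
  have hfin := IsFinitaryCategory.finite_hom (k := k) (𝒜 := 𝒜)
  have : s.Faithful := Functor.Faithful.of_comp_iso e
  have : p.EssSurj := ⟨fun X => ⟨s.obj X, ⟨e.app X⟩⟩⟩
  have := p.hasFiniteProducts_of_additive_of_essSurj
  have := HasFiniteBiproducts.of_hasFiniteProducts (C := ℬ)
  have := isIdempotentComplete_of_retract e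
  obtain ⟨t, ht, h⟩ := IsFinitaryCategory.finite_indecomposables (k := k) (𝒜 := 𝒜)
  refine
    { finite_hom := fun X Y => Module.Finite.of_injective (s.mapLinearMap k) s.map_injective
      finite_indecomposables := ⟨p.obj '' t, ht.image _, fun X hX => ?_⟩ }
  obtain ⟨Y, hY, ⟨f⟩⟩ := exists_isIndecomposable_of_isIndecomposable_obj (k := k) p (s.obj X)
    (hX.of_iso (e.app X).symm)
  obtain ⟨Z, hZ, ⟨g⟩⟩ := h Y hY
  exact ⟨_, ⟨Z, hZ, rfl⟩, ⟨(e.app X).symm ≪≫ f ≪≫ p.mapIso g⟩⟩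

section LinearOfFullyFaithful

variable [Linear k ℬ] {F : 𝒜 ⥤ ℬ} [F.Additive] (hF : F.FullyFaithful)

variable (k) in
/-- The linear structure transported along a fully faithful additive functor. -/
abbrev linearOfFullyFaithful : Linear k 𝒜 :=
  letI (X Y : 𝒜) : SMul k (X ⟶ Y) := ⟨fun r f => hF.preimage (r • F.map f)⟩
  have map_smul {X Y : 𝒜} (r : k) (f : X ⟶ Y) : F.map (r • f) = r • F.map f := hF.map_preimage _
  { homModule := fun X Y =>
      Function.Injective.module k F.mapAddHom (fun _ _ h => hF.map_injective h) map_smul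
    smul_comp := fun X Y Z r f g => hF.map_injective (by
      rw [F.map_comp, map_smul, Linear.smul_comp, ← F.map_comp]; exact (map_smul r _).symm)
    comp_smul := fun X Y Z f r g => hF.map_injective (by
      rw [F.map_comp, map_smul, Linear.comp_smul, ← F.map_comp]; exact (map_smul r _).symm) }

theorem linear_of_fullyFaithful :
    letI := linearOfFullyFaithful k hF
    F.Linear k :=
  letI := linearOfFullyFaithful k hF
  ⟨fun f r => hF.map_preimage (r • F.map f)⟩

end LinearOfFullyFaithful

/-- The category is replaced by its full subcategory on the objects `p.obj X` with morphism types
shrunk, so as to be in the universes of `A`. -/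
theorem exists_finAddCat_equivalence_of_retract [Linear k ℬ] (A : FinAddCat.{w, v, u} k)
    {s : ℬ ⥤ A.carrier} {p : A.carrier ⥤ ℬ} (hs : IsLinearFunctor k _ _ s) [p.Additive]
    (e : s ⋙ p ≅ 𝟭 ℬ) :
    ∃ (S : FinAddCat.{w, v, u} k) (E : S.carrier ≌ ℬ), IsLinearFunctor k _ _ E.functor := by
  have : s.Faithful := Functor.Faithful.of_comp_iso e
  let I := InducedCategory ℬ p.obj
  have : LocallySmall.{v} I := ⟨fun X Y => small_of_injective
    (f := fun f : X ⟶ Y => s.map ((inducedFunctor p.obj).map f))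
    (fun f g h => (inducedFunctor p.obj).map_injective (s.map_injective h))⟩
  have : (inducedFunctor p.obj).EssSurj := ⟨fun X => ⟨s.obj X, ⟨e.app X⟩⟩⟩
  have : (inducedFunctor p.obj).IsEquivalence := {}
  let E : ShrinkHoms I ≌ ℬ :=
    (ShrinkHoms.equivalence I).symm.trans (inducedFunctor p.obj).asEquivalence
  have : E.functor.Additive :=
    inferInstanceAs (ShrinkHoms.inverse I ⋙ inducedFunctor p.obj).Additive
  let _ : Linear k (ShrinkHoms I) := linearOfFullyFaithful k E.fullyFaithfulFunctor
  have hE : IsLinearFunctor k _ _ E.functor := ⟨inferInstance, linear_of_fullyFaithful _⟩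
  obtain ⟨_, _⟩ := hE.comp hs
  have := E.inverse_additive
  have : IsFinitaryCategory k (ShrinkHoms I) :=
    .of_retract (s := E.functor ⋙ s) (p := p ⋙ E.inverse) (Functor.associator _ _ _ ≪≫
      Functor.isoWhiskerLeft E.functor ((Functor.associator _ _ _).symm ≪≫
        Functor.isoWhiskerRight e E.inverse ≪≫ E.inverse.leftUnitor) ≪≫ E.unitIso.symm)
  exact ⟨⟨ShrinkHoms I⟩, E, hE⟩

end Finitary

/-! ### Category-valued homomorphisms -/

section CategoryValued

variable {B : Type u} [Bicategory.{w, v} B]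

/-- A homomorphism from the bicategory `B` to the 2-category of categories, written
componentwise so that the values may live in arbitrary universes. The functor `act` collects the
actions of 1-morphisms and of 2-morphisms. -/
structure CatRep (B : Type u) [Bicategory.{w, v} B] (S : B → Type a₁)
    [∀ i, Category.{b₁} (S i)] where
  act {i j : B} : (i ⟶ j) ⥤ S i ⥤ S j
  actId (i : B) : act.obj (𝟙 i) ≅ 𝟭 (S i)
  actComp {i j l : B} (F : i ⟶ j) (G : j ⟶ l) : act.obj (F ≫ G) ≅ act.obj F ⋙ act.obj G
  act_whiskerLeft {i j l : B} (F : i ⟶ j) {G G' : j ⟶ l} (β : G ⟶ G') (X : S i) :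
    (act.map (F ◁ β)).app X ≫ (actComp F G').hom.app X =
      (actComp F G).hom.app X ≫ (act.map β).app ((act.obj F).obj X)
  act_whiskerRight {i j l : B} {F F' : i ⟶ j} (α : F ⟶ F') (G : j ⟶ l) (X : S i) :
    (act.map (α ▷ G)).app X ≫ (actComp F' G).hom.app X =
      (actComp F G).hom.app X ≫ (act.obj G).map ((act.map α).app X)
  act_associator {i j l m : B} (F : i ⟶ j) (G : j ⟶ l) (H : l ⟶ m) (X : S i) :
    (act.map (α_ F G H).hom).app X ≫ (actComp F (G ≫ H)).hom.app X ≫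
        (actComp G H).hom.app ((act.obj F).obj X) =
      (actComp (F ≫ G) H).hom.app X ≫ (act.obj H).map ((actComp F G).hom.app X)
  act_leftUnitor {i j : B} (F : i ⟶ j) (X : S i) :
    (act.map (λ_ F).hom).app X =
      (actComp (𝟙 i) F).hom.app X ≫ (act.obj F).map ((actId i).hom.app X)
  act_rightUnitor {i j : B} (F : i ⟶ j) (X : S i) :
    (act.map (ρ_ F).hom).app X =
      (actComp F (𝟙 j)).hom.app X ≫ (actId j).hom.app ((act.obj F).obj X)

variable {S : B → Type a₁} [∀ i, Category.{b₁} (S i)] {T : B → Type a₂} [∀ i, Category.{b₂} (T i)]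
  {U : B → Type a₃} [∀ i, Category.{b₃} (U i)]

/-- A strong transformation of category-valued homomorphisms, written componentwise. -/
structure CatTrans (M : CatRep B S) (N : CatRep B T) where
  app (i : B) : S i ⥤ T i
  nat {i j : B} (F : i ⟶ j) : M.act.obj F ⋙ app j ≅ app i ⋙ N.act.obj F
  nat_act {i j : B} {F G : i ⟶ j} (α : F ⟶ G) (X : S i) :
    (app j).map ((M.act.map α).app X) ≫ (nat G).hom.app X =
      (nat F).hom.app X ≫ (N.act.map α).app ((app i).obj X)
  nat_id (i : B) (X : S i) :
    (nat (𝟙 i)).hom.app X ≫ (N.actId i).hom.app ((app i).obj X) =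
      (app i).map ((M.actId i).hom.app X)
  nat_comp {i j l : B} (F : i ⟶ j) (G : j ⟶ l) (X : S i) :
    (nat (F ≫ G)).hom.app X ≫ (N.actComp F G).hom.app ((app i).obj X) =
      (app l).map ((M.actComp F G).hom.app X) ≫ (nat G).hom.app ((M.act.obj F).obj X) ≫
        (N.act.obj G).map ((nat F).hom.app X)

/-- A modification of strong transformations, written componentwise. -/
@[ext]
structure CatMod {M : CatRep B S} {N : CatRep B T} (Λ Θ : CatTrans M N) where
  app (i : B) : Λ.app i ⟶ Θ.app i
  nat {i j : B} (F : i ⟶ j) (X : S i) :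
    (app j).app ((M.act.obj F).obj X) ≫ (Θ.nat F).hom.app X =
      (Λ.nat F).hom.app X ≫ (N.act.obj F).map ((app i).app X)

namespace CatRep

variable (M : CatRep B S)

theorem actId_naturality (i : B) {X Y : S i} (f : X ⟶ Y) :
    (M.act.obj (𝟙 i)).map f ≫ (M.actId i).hom.app Y = (M.actId i).hom.app X ≫ f :=
  (M.actId i).hom.naturality f

theorem actComp_naturality {i j l : B} (F : i ⟶ j) (G : j ⟶ l) {X Y : S i} (f : X ⟶ Y) :
    (M.act.obj (F ≫ G)).map f ≫ (M.actComp F G).hom.app Y =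
      (M.actComp F G).hom.app X ≫ (M.act.obj G).map ((M.act.obj F).map f) :=
  (M.actComp F G).hom.naturality f

end CatRep

namespace CatTrans

variable {M : CatRep B S} {N : CatRep B T} {P : CatRep B U}

theorem nat_naturality (Λ : CatTrans M N) {i j : B} (F : i ⟶ j) {X Y : S i} (f : X ⟶ Y) :
    (Λ.app j).map ((M.act.obj F).map f) ≫ (Λ.nat F).hom.app Y =
      (Λ.nat F).hom.app X ≫ (N.act.obj F).map ((Λ.app i).map f) :=
  (Λ.nat F).hom.naturality f

@[simps! id_app comp_app]
instance homCategory : Category (CatTrans M N) where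
  Hom Λ Θ := CatMod Λ Θ
  id Λ :=
    { app := fun i => 𝟙 (Λ.app i)
      nat := fun F X => by simp }
  comp Γ Γ' :=
    { app := fun i => Γ.app i ≫ Γ'.app i
      nat := fun F X => by simp [Γ'.nat, reassoc_of% Γ.nat] }

@[ext]
theorem hom_ext {Λ Θ : CatTrans M N} {Γ Γ' : Λ ⟶ Θ}
    (h : ∀ i X, (Γ.app i).app X = (Γ'.app i).app X) : Γ = Γ' :=
  CatMod.ext (funext fun i => NatTrans.ext (funext (h i)))

/-- The components of an isomorphism of transformations. -/
@[simps]
def appIso {Λ Θ : CatTrans M N} (e : Λ ≅ Θ) (i : B) : Λ.app i ≅ Θ.app i where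
  hom := e.hom.app i
  inv := e.inv.app i
  hom_inv_id := congr(($e.hom_inv_id).app i)
  inv_hom_id := congr(($e.inv_hom_id).app i)

/-- An isomorphism of transformations from componentwise isomorphisms compatible with the
constraints of the source and the target. -/
@[simps]
def isoMk {Λ Θ : CatTrans M N} (e : ∀ i, Λ.app i ≅ Θ.app i)
    (h : ∀ {i j : B} (F : i ⟶ j) (X : S i),
      (e j).hom.app ((M.act.obj F).obj X) ≫ (Θ.nat F).hom.app X =
        (Λ.nat F).hom.app X ≫ (N.act.obj F).map ((e i).hom.app X)) : Λ ≅ Θ where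
  hom := { app := fun i => (e i).hom, nat := h }
  inv :=
    { app := fun i => (e i).inv
      nat := fun F X => by
        rw [← cancel_epi ((e _).hom.app _), reassoc_of% h F X]
        simp [← Functor.map_comp] }

/-- Composition of strong transformations. -/
abbrev comp (Λ : CatTrans M N) (Θ : CatTrans N P) : CatTrans M P where
  app i := Λ.app i ⋙ Θ.app i
  nat {i j} F :=
    Functor.isoWhiskerRight (Λ.nat F) (Θ.app j) ≪≫ Functor.isoWhiskerLeft (Λ.app i) (Θ.nat F)
  nat_act α X := by simp [← Θ.nat_act, ← Functor.map_comp_assoc, Λ.nat_act, -Functor.map_comp]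
  nat_id i X := by simp [Θ.nat_id, ← Functor.map_comp, Λ.nat_id]
  nat_comp F G X := by
    have h := congrArg (Θ.app _).map (Λ.nat_comp F G X)
    simp only [Functor.map_comp] at h
    simp [Θ.nat_comp, reassoc_of% h, ← reassoc_of% Θ.nat_naturality]

/-- Composition with a fixed transformation `Θ : N ⟶ P`, as a functor. -/
abbrev postcomp (M : CatRep B S) (Θ : CatTrans N P) : CatTrans M N ⥤ CatTrans M P where
  obj Λ := Λ.comp Θ
  map {Λ Λ'} Γ :=
    { app := fun i => Functor.whiskerRight (Γ.app i) (Θ.app i)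
      nat := fun {i j} F X => by
        simp [← Θ.nat_naturality, ← Functor.map_comp_assoc, Γ.nat, -Functor.map_comp] }

/-- Composition with a fixed transformation `Λ : M ⟶ N`, as a functor. -/
abbrev precomp (Λ : CatTrans M N) (P : CatRep B U) : CatTrans N P ⥤ CatTrans M P where
  obj Θ := Λ.comp Θ
  map {Θ Θ'} Γ :=
    { app := fun i => Functor.whiskerLeft (Λ.app i) (Γ.app i)
      nat := fun F X => by simp [← Γ.nat] }

section Lift

variable (Θ : CatTrans N P) [∀ i, (Θ.app i).Full] [∀ i, (Θ.app i).Faithful] (Λ : CatTrans M P)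
  {L : ∀ i, S i ⥤ T i} (e : ∀ i, L i ⋙ Θ.app i ≅ Λ.app i)

/-- The constraint on `L` induced by that of a transformation `Λ` isomorphic to the composite of
`L` with the fully faithful transformation `Θ`. -/
def liftNat {i j : B} (F : i ⟶ j) : M.act.obj F ⋙ L j ≅ L i ⋙ N.act.obj F :=
  ((Functor.FullyFaithful.ofFullyFaithful (Θ.app j)).whiskeringRight (S i)).preimageIso
    (Functor.isoWhiskerLeft (M.act.obj F) (e j) ≪≫ Λ.nat F ≪≫
      Functor.isoWhiskerRight (e i).symm (P.act.obj F) ≪≫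
      Functor.isoWhiskerLeft (L i) (Θ.nat F).symm)

theorem map_liftNat_hom_app {i j : B} (F : i ⟶ j) (X : S i) :
    (Θ.app j).map ((liftNat Θ Λ e F).hom.app X) ≫ (Θ.nat F).hom.app ((L i).obj X) ≫
        (P.act.obj F).map ((e i).hom.app X) =
      (e j).hom.app ((M.act.obj F).obj X) ≫ (Λ.nat F).hom.app X := by
  simp [liftNat, ← Functor.map_comp]

/-- The lift of a transformation along a fully faithful transformation. -/
abbrev lift : CatTrans M N where
  app := L
  nat F := liftNat Θ Λ e F
  nat_act {i j F G} α X := (Θ.app j).map_injective (by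
    have he := (e j).hom.naturality ((M.act.map α).app X)
    dsimp at he
    rw [← cancel_mono ((Θ.nat G).hom.app ((L i).obj X) ≫ (P.act.obj G).map ((e i).hom.app X))]
    simp only [Functor.map_comp, Category.assoc, map_liftNat_hom_app, reassoc_of% he, Λ.nat_act,
      reassoc_of% Θ.nat_act, ← NatTrans.naturality,
      reassoc_of% map_liftNat_hom_app Θ Λ e F X])
  nat_id i X := (Θ.app i).map_injective (by
    have he := (e i).hom.naturality ((M.actId i).hom.app X)
    dsimp at he
    rw [← cancel_mono ((e i).hom.app X)]
    simp only [Functor.map_comp, Category.assoc, he, ← Λ.nat_id, ← Θ.nat_id, ← P.actId_naturality,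
      reassoc_of% map_liftNat_hom_app Θ Λ e (𝟙 i) X])
  nat_comp {i j l} F G X := (Θ.app l).map_injective (by
    have he := (e l).hom.naturality ((M.actComp F G).hom.app X)
    have hF := congrArg (P.act.obj G).map (map_liftNat_hom_app Θ Λ e F X)
    have hΘ := Θ.nat_naturality G ((liftNat Θ Λ e F).hom.app X)
    dsimp at he hΘ
    simp only [Functor.map_comp] at hF
    rw [← cancel_mono ((Θ.nat G).hom.app _ ≫ (P.act.obj G).map ((Θ.nat F).hom.app ((L i).obj X)) ≫
      (P.act.obj G).map ((P.act.obj F).map ((e i).hom.app X)))]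
    simp only [Functor.map_comp, Category.assoc, ← reassoc_of% Θ.nat_comp, ← P.actComp_naturality,
      reassoc_of% map_liftNat_hom_app Θ Λ e (F ≫ G) X, Λ.nat_comp, reassoc_of% he,
      reassoc_of% hΘ, hF, reassoc_of% map_liftNat_hom_app Θ Λ e G _])

end Lift

theorem faithful_postcomp (M : CatRep B S) (Θ : CatTrans N P) [∀ i, (Θ.app i).Faithful] :
    (postcomp M Θ).Faithful where
  map_injective {Λ Λ' Γ Γ'} h := by
    ext i X
    exact (Θ.app i).map_injective congr($(h).app i |>.app X)

theorem full_postcomp (M : CatRep B S) (Θ : CatTrans N P) [∀ i, (Θ.app i).Full]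
    [∀ i, (Θ.app i).Faithful] : (postcomp M Θ).Full where
  map_surjective {Λ Λ'} Γ := by
    let Γ₀ (i : B) : Λ.app i ⟶ Λ'.app i :=
      ((Functor.FullyFaithful.ofFullyFaithful (Θ.app i)).whiskeringRight (S i)).preimage (Γ.app i)
    have map_Γ₀ (i : B) (X : S i) : (Θ.app i).map ((Γ₀ i).app X) = (Γ.app i).app X := by simp [Γ₀]
    refine ⟨{ app := Γ₀, nat := fun {i j} F X => (Θ.app j).map_injective ?_ }, ?_⟩
    · rw [← cancel_mono ((Θ.nat F).hom.app _)]
      simpa [map_Γ₀, Θ.nat_naturality] using Γ.nat F X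
    · ext i X
      exact map_Γ₀ i X

theorem isEquivalence_postcomp (M : CatRep B S) (Θ : CatTrans N P)
    [∀ i, (Θ.app i).IsEquivalence] : (postcomp M Θ).IsEquivalence where
  faithful := faithful_postcomp M Θ
  full := full_postcomp M Θ
  essSurj.mem_essImage Λ :=
    let e (i : B) : (Λ.app i ⋙ (Θ.app i).inv) ⋙ Θ.app i ≅ Λ.app i :=
      Functor.isoWhiskerLeft (Λ.app i) (Θ.app i).asEquivalence.counitIso
    ⟨lift Θ Λ e, ⟨isoMk e fun F X => by simp [← map_liftNat_hom_app Θ Λ e F X]⟩⟩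

end CatTrans

end CategoryValued

section Restriction

variable {C : Type u} [Bicategory.{w, v} C] {S : C → Type a₁} [∀ i, Category.{b₁} (S i)]
  {T : C → Type a₂} [∀ i, Category.{b₂} (T i)]

namespace CatRep

variable (M : CatRep C S) (D : Set C)

/-- The unit constraint of the restriction of `M` to `D`. It includes the (identity) constraint of
the inclusion, as that of a composite homomorphism does. -/
def restrictActId (l : FullSub D) : M.act.obj (𝟙 l : l ⟶ l).hom ≅ 𝟭 (S l.1) :=
  M.act.mapIso ((FullSub.incl D).mapId l) ≪≫ M.actId l.1

@[simp]
theorem restrictActId_hom_app (l : FullSub D) (X : S l.1) :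
    (M.restrictActId D l).hom.app X = (M.actId l.1).hom.app X :=
  (congr($(M.act.map_id _).app X ≫ _)).trans (Category.id_comp _)

/-- The composition constraint of the restriction of `M` to `D`. -/
def restrictActComp {l m n : FullSub D} (F : l ⟶ m) (G : m ⟶ n) :
    M.act.obj (F ≫ G).hom ≅ M.act.obj F.hom ⋙ M.act.obj G.hom :=
  M.act.mapIso ((FullSub.incl D).mapComp F G) ≪≫ M.actComp F.hom G.hom

@[simp]
theorem restrictActComp_hom_app {l m n : FullSub D} (F : l ⟶ m) (G : m ⟶ n) (X : S l.1) :
    (M.restrictActComp D F G).hom.app X = (M.actComp F.hom G.hom).hom.app X :=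
  (congr($(M.act.map_id _).app X ≫ _)).trans (Category.id_comp _)

/-- Restriction of a category-valued homomorphism to the full sub-bicategory on `D`. -/
abbrev restrict : CatRep (FullSub D) (fun l => S l.1) where
  act :=
    { obj := fun F => M.act.obj F.hom
      map := fun α => M.act.map α.hom
      map_id := fun F => M.act.map_id F.hom
      map_comp := fun α β => M.act.map_comp α.hom β.hom }
  actId l := M.restrictActId D l
  actComp F G := M.restrictActComp D F G
  act_whiskerLeft F G G' β X := by
    simp only [restrictActComp_hom_app]
    exact M.act_whiskerLeft F.hom β.hom X
  act_whiskerRight α G X := by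
    simp only [restrictActComp_hom_app]
    exact M.act_whiskerRight α.hom G.hom X
  act_associator F G H X := by
    simp only [restrictActComp_hom_app]
    exact M.act_associator F.hom G.hom H.hom X
  act_leftUnitor F X := by
    simp only [restrictActComp_hom_app, restrictActId_hom_app]
    exact M.act_leftUnitor F.hom X
  act_rightUnitor F X := by
    simp only [restrictActComp_hom_app, restrictActId_hom_app]
    exact M.act_rightUnitor F.hom X

end CatRep

namespace CatTrans

variable {M : CatRep C S} {N : CatRep C T}

/-- Restriction of a strong transformation to the full sub-bicategory on `D`. -/
abbrev restrict (Λ : CatTrans M N) (D : Set C) : CatTrans (M.restrict D) (N.restrict D) where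
  app l := Λ.app l.1
  nat F := Λ.nat F.hom
  nat_act α X := Λ.nat_act α.hom X
  nat_id l X := by
    simp only [CatRep.restrictActId_hom_app]
    exact Λ.nat_id l.1 X
  nat_comp F G X := by
    simp only [CatRep.restrictActComp_hom_app]
    exact Λ.nat_comp F.hom G.hom X

variable (M N) in
/-- Restriction to `D` of transformations and modifications. -/
abbrev restriction (D : Set C) : CatTrans M N ⥤ CatTrans (M.restrict D) (N.restrict D) where
  obj Λ := Λ.restrict D
  map Γ :=
    { app := fun l => Γ.app l.1
      nat := fun F X => Γ.nat F.hom X }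

end CatTrans

end Restriction

/-! ### Extension by families -/

section Families

variable {C : Type u} [Bicategory.{w, v} C]

/-- The category-valued homomorphism corepresented by the object `i`. -/
abbrev corepr (i : C) : CatRep C (fun j => i ⟶ j) where
  act :=
    { obj := fun F =>
        { obj := fun G => G ≫ F
          map := fun α => α ▷ F }
      map := fun α =>
        { app := fun G => G ◁ α
          naturality := fun _ _ f => (whisker_exchange f α).symm } }
  actId j := NatIso.ofComponents (fun G => ρ_ G)
  actComp F G := NatIso.ofComponents (fun H => (α_ H F G).symm)
  act_whiskerLeft F G G' β X := by simp
  act_whiskerRight α G X := by simp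
  act_associator F G H X := by simp
  act_leftUnitor F X := by simp
  act_rightUnitor F X := by simp

/-- Precomposition with the 1-morphism `F`, as a transformation of corepresented homomorphisms. -/
abbrev coreprMap {i j : C} (F : i ⟶ j) : CatTrans (corepr j) (corepr i) where
  app l :=
    { obj := fun G => F ≫ G
      map := fun α => F ◁ α }
  nat H := NatIso.ofComponents (fun G => (α_ F G H).symm)
  nat_act α X := by simp
  nat_id j X := by simp
  nat_comp G H X := by simp

variable {S : C → Type a₁} [∀ i, Category.{b₁} (S i)]

/-- The transformation out of a corepresented homomorphism determined by an object. -/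
abbrev coreprTrans (N : CatRep C S) {i : C} (X : S i) : CatTrans (corepr i) N where
  app j :=
    { obj := fun G => (N.act.obj G).obj X
      map := fun α => (N.act.map α).app X }
  nat F := NatIso.ofComponents (fun G => (N.actComp G F).app X)
    (fun α => by simp [N.act_whiskerRight])
  nat_act α G := by simp [N.act_whiskerLeft]
  nat_id j G := by simp [N.act_rightUnitor]
  nat_comp F G H := by
    have h := N.act_associator H F G X
    have hα := congr($((N.act.mapIso (α_ H F G)).inv_hom_id).app X)
    dsimp at h hα ⊢
    simp [← h, reassoc_of% hα]

variable (D : Set C)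

/-- A family on `i` with values in `M`: an object of `M l` for each 1-morphism from `i` to an object
`l` of `D`, compatibly with the action of `M`. -/
abbrev Family (i : C) {S : FullSub D → Type a₁} [∀ l, Category.{b₁} (S l)]
    (M : CatRep (FullSub D) S) :=
  CatTrans ((corepr i).restrict D) M

variable {D} {S : FullSub D → Type a₁} [∀ l, Category.{b₁} (S l)] {M : CatRep (FullSub D) S}
  {i j : C}

/-- The action of a 2-morphism on families: the modification from the pullback of `A` along its
source to the pullback of `A` along its target. -/
abbrev ranActMap (A : Family D i M) {F F' : i ⟶ j} (α : F ⟶ F') :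
    ((coreprMap F).restrict D).comp A ⟶ ((coreprMap F').restrict D).comp A where
  app l :=
    { app := fun G => (A.app l).map (α ▷ G)
      naturality := fun _ _ f => by
        simp [← Functor.map_comp, whisker_exchange] }
  nat F G := by
    have h := A.nat_naturality F (α ▷ G)
    dsimp at h
    simp [← h, ← Functor.map_comp_assoc, -Functor.map_comp]

/-- The unit constraint of the action of 1-morphisms on families. -/
abbrev ranActId (i : C) :
    CatTrans.precomp ((coreprMap (𝟙 i)).restrict D) M ≅ 𝟭 (Family D i M) :=
  NatIso.ofComponents
    (fun A => CatTrans.isoMk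
      (fun l => NatIso.ofComponents (fun G => (A.app l).mapIso (λ_ G))
        (fun f => by simp [← Functor.map_comp]))
      (fun F G => by
        have h := A.nat_naturality F (λ_ G).hom
        dsimp at h
        simp [← h, ← Functor.map_comp_assoc, -Functor.map_comp]))
    (fun f => by ext; simp)

/-- The composition constraint of the action of 1-morphisms on families. -/
abbrev ranActComp {l : C} (F : i ⟶ j) (G : j ⟶ l) :
    CatTrans.precomp ((coreprMap (F ≫ G)).restrict D) M ≅
      CatTrans.precomp ((coreprMap F).restrict D) M ⋙
        CatTrans.precomp ((coreprMap G).restrict D) M :=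
  NatIso.ofComponents
    (fun A => CatTrans.isoMk
      (fun m => NatIso.ofComponents (fun H => (A.app m).mapIso (α_ F G H))
        (fun f => by simp [← Functor.map_comp]))
      (fun H K => by
        have h := A.nat_naturality H (α_ F G K).hom
        dsimp at h
        simp [← h, ← Functor.map_comp_assoc, -Functor.map_comp]))
    (fun f => by ext; simp)

variable (M) in
/-- The extension of `M` from `D` to the whole bicategory by its categories of families, on which
1-morphisms act by precomposition. This is the bicategorical right Kan extension. -/
abbrev ran : CatRep C (fun i => Family D i M) where
  act :=
    { obj := fun F => CatTrans.precomp ((coreprMap F).restrict D) M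
      map := fun α =>
        { app := fun A => ranActMap A α
          naturality := fun A B f => by ext; simp }
      map_id := fun F => by ext; simp
      map_comp := fun α β => by ext; simp }
  actId i := ranActId i
  actComp F G := ranActComp F G
  act_whiskerLeft F G G' β X := by ext; simp [← Functor.map_comp]
  act_whiskerRight α G X := by ext; simp [← Functor.map_comp]
  act_associator F G H X := by ext; simp [← Functor.map_comp]
  act_leftUnitor F X := by ext; simp [← Functor.map_comp]
  act_rightUnitor F X := by ext; simp [← Functor.map_comp]

/-- For an object of `D`, the comparison of the homomorphism it corepresents on `C`, restricted to
`D`, with the one it corepresents on `D`. -/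
abbrev coreprIncl (l : FullSub D) : CatTrans ((corepr l.1).restrict D) (corepr l) where
  app m :=
    { obj := fun G => InducedBicategory.mkHom G
      map := fun α => ⟨α⟩
      map_id := fun _ => rfl
      map_comp := fun _ _ => rfl }
  nat F := NatIso.ofComponents (fun G => Iso.refl (InducedBicategory.mkHom (G ≫ F.hom)))
    (fun α => InducedBicategory.hom₂_ext ((Category.comp_id _).trans (Category.id_comp _).symm))
  nat_act α G := InducedBicategory.hom₂_ext ((Category.comp_id _).trans (Category.id_comp _).symm)
  nat_id m G := InducedBicategory.hom₂_ext (by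
    simp only [CatRep.restrictActId_hom_app]
    exact Category.id_comp _)
  nat_comp F G H := InducedBicategory.hom₂_ext (by
    simp only [CatRep.restrictActComp_hom_app]
    change 𝟙 _ ≫ (α_ H F.hom G.hom).inv =
      (α_ H F.hom G.hom).inv ≫ 𝟙 _ ≫ 𝟙 (H ≫ F.hom) ▷ G.hom
    simp)

variable {T : C → Type a₂} [∀ i, Category.{b₂} (T i)] (N : CatRep C T)

/-- The transformation determined by an object, as a functor of that object. -/
abbrev coreprTransFunctor (i : C) : T i ⥤ CatTrans (corepr i) N where
  obj X := coreprTrans N X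
  map f :=
    { app := fun j => { app := fun G => (N.act.obj G).map f }
      nat := fun F G => by simp [N.actComp_naturality] }

/-- The compatibility of `coreprTrans` with the action of a 1-morphism. -/
abbrev coreprTransActIso {i j : C} (F : i ⟶ j) (X : T i) :
    coreprTrans N ((N.act.obj F).obj X) ≅ (coreprMap F).comp (coreprTrans N X) :=
  CatTrans.isoMk
    (fun l => NatIso.ofComponents (fun G => ((N.actComp F G).app X).symm)
      (fun α => by
        simp [← cancel_epi ((N.actComp F _).hom.app X), ← reassoc_of% N.act_whiskerLeft]))
    (fun G H => by
      have h := N.act_associator F H G X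
      have hα := congr($((N.act.mapIso (α_ F H G)).inv_hom_id).app X)
      dsimp at h hα ⊢
      rw [← cancel_mono ((N.act.obj G).map ((N.actComp F H).hom.app X))]
      simp [← h, reassoc_of% hα, ← Functor.map_comp])

variable (D) in
/-- The unit of the extension: the comparison of a homomorphism with the extension of its
restriction to `D`, sending `X` to the family of the objects `N(G) X`. -/
abbrev ranUnit : CatTrans N (ran (N.restrict D)) where
  app i := coreprTransFunctor N i ⋙ CatTrans.restriction _ N D
  nat F := NatIso.ofComponents
    (fun X => (CatTrans.restriction _ N D).mapIso (coreprTransActIso N F X))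
    (fun f => by
      ext l G
      simp [← cancel_epi ((N.actComp F G).hom.app _), ← reassoc_of% N.actComp_naturality])
  nat_act α X := by
    ext l G
    simp [← cancel_epi ((N.actComp _ G).hom.app _), ← reassoc_of% N.act_whiskerRight]
  nat_id i X := by
    ext l G
    simp [N.act_leftUnitor]
  nat_comp F G X := by
    ext l H
    simp [← cancel_epi ((N.actComp (F ≫ G) H).hom.app _), ← reassoc_of% N.act_associator]

variable {S : FullSub D → Type a₁} [∀ l, Category.{b₁} (S l)]

/-- Evaluation of families at a 1-morphism. -/
abbrev evalFamily (M : CatRep (FullSub D) S) {i : C} (l : FullSub D) (G : i ⟶ l.1) :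
    Family D i M ⥤ S l where
  obj A := (A.app l).obj G
  map f := (f.app l).app G

/-- The counit of the extension: evaluation of a family on an object of `D` at its identity. -/
abbrev ranCounit (M : CatRep (FullSub D) S) : CatTrans ((ran M).restrict D) M where
  app l := evalFamily M l (𝟙 l.1)
  nat {l m} F := NatIso.ofComponents
    (fun A => (A.app m).mapIso (ρ_ F.hom ≪≫ (λ_ F.hom).symm) ≪≫ (A.nat F).app (𝟙 l.1))
    (fun {A B} f => by
      have h := f.nat F (𝟙 l.1)
      dsimp at h
      simp [← h])
  nat_act {l m F G} α A := by
    have h := A.nat_act α (𝟙 _)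
    dsimp at h
    simp [← h, ← Functor.map_comp_assoc, -Functor.map_comp]
  nat_id l A := by
    have h := A.nat_id l (𝟙 _)
    simpa using h
  nat_comp {l m n} F G A := by
    have h := A.nat_comp F G (𝟙 _)
    have hρ := A.nat_naturality G ((ρ_ F.hom).hom ≫ (λ_ F.hom).inv)
    dsimp at h hρ
    simp only [Functor.map_comp, CatRep.restrictActComp_hom_app] at h hρ
    simp only [InducedBicategory.categoryStruct_comp_hom, Functor.comp_obj,
      Functor.mapIso_trans, Functor.mapIso_symm, Iso.trans_assoc, NatIso.ofComponents_hom_app,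
      Iso.trans_hom, Functor.mapIso_hom, Iso.symm_hom, Functor.mapIso_inv, Iso.app_hom,
      Category.assoc, h, CatRep.restrictActComp_hom_app, CatTrans.isoMk_hom_app, NatIso.trans_app,
      Functor.comp_map, Functor.map_comp, Functor.isoWhiskerRight_hom, Functor.whiskerRight_app,
      Functor.isoWhiskerLeft_hom, Functor.whiskerLeft_app, ← reassoc_of% hρ]
    simp [← Functor.map_comp_assoc, -Functor.map_comp]

/-- The extension of a transformation, acting on families by composition. -/
abbrev ranMap {U : FullSub D → Type a₂} [∀ l, Category.{b₂} (U l)] {M : CatRep (FullSub D) S}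
    {N : CatRep (FullSub D) U} (Λ : CatTrans M N) : CatTrans (ran M) (ran N) where
  app i := CatTrans.postcomp _ Λ
  nat F := NatIso.ofComponents
    (fun A => CatTrans.isoMk (fun l => Iso.refl _) (fun F X => by simp)) (fun f => by ext; simp)
  nat_act α A := by ext; simp
  nat_id l A := by ext; simp
  nat_comp {l m n} F G A := by ext; simp

/-- A presentation of `i` as a retract, up to isomorphism, of an object of `D`. -/
structure RetractOf (D : Set C) (i : C) where
  obj : FullSub D
  proj : obj.1 ⟶ i
  incl : i ⟶ obj.1
  iso : incl ≫ proj ≅ 𝟙 i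

/-- The action of a homomorphism on a retract: the actions of `r.incl` and `r.proj` compose to the
identity. -/
def RetractOf.actIso {i : C} (r : RetractOf D i) (N : CatRep C T) :
    N.act.obj r.incl ⋙ N.act.obj r.proj ≅ 𝟭 (T i) :=
  (N.actComp r.incl r.proj).symm ≪≫ N.act.mapIso r.iso ≪≫ N.actId i

/-- The family on an object `l` of `D` generated by an object `X` of `M l`: the objects `M(G) X`. -/
abbrev generatedFamily (M : CatRep (FullSub D) S) (l : FullSub D) : S l ⥤ Family D l.1 M :=
  coreprTransFunctor M l ⋙ CatTrans.precomp (coreprIncl l) M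

/-- The family generated by the value of a family at a 1-morphism `F : i ⟶ l` is its pullback
along `F`. -/
def evalGeneratedIso (M : CatRep (FullSub D) S) {i : C} (l : FullSub D) (F : i ⟶ l.1) :
    evalFamily M l F ⋙ generatedFamily M l ≅ (ran M).act.obj F :=
  NatIso.ofComponents
    (fun A => CatTrans.isoMk
      (fun m => NatIso.ofComponents
        (fun G => ((A.nat (InducedBicategory.mkHom G)).app F).symm)
        (fun {G G'} α => by
          have h := A.nat_act (F := InducedBicategory.mkHom G) (G := InducedBicategory.mkHom G')
            ⟨α⟩ F
          dsimp at h
          simp [← cancel_epi ((A.nat (InducedBicategory.mkHom G)).hom.app F), ← reassoc_of% h]))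
      (fun {m n} H G => by
        have h : (A.app n).map (α_ F G H.hom).inv ≫ (A.nat H).hom.app (F ≫ G) ≫
              (M.act.obj H).map ((A.nat (InducedBicategory.mkHom G)).hom.app F) =
            (A.nat (InducedBicategory.mkHom (G ≫ H.hom))).hom.app F ≫
              (M.actComp (InducedBicategory.mkHom G) H).hom.app ((A.app l).obj F) := by
          have h := A.nat_comp (InducedBicategory.mkHom G) H F
          rw [CatRep.restrictActComp_hom_app] at h
          exact h.symm
        rw [← cancel_epi ((A.nat (InducedBicategory.mkHom (G ≫ H.hom))).hom.app F),
          ← cancel_mono ((M.act.obj H).map ((A.nat (InducedBicategory.mkHom G)).hom.app F))]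
        simpa [← Functor.map_comp] using h))
    (fun {A B} f => by
      ext m G
      have h := f.nat (InducedBicategory.mkHom G) F
      dsimp at h ⊢
      simp [← cancel_epi ((A.nat (InducedBicategory.mkHom G)).hom.app F), ← reassoc_of% h])

/-- A family is the pullback along `r.proj` of the family generated by its value at `r.incl`. -/
def RetractOf.familyIso {M : CatRep (FullSub D) S} {i : C} (r : RetractOf D i)
    (A : Family D i M) :
    ((coreprMap r.proj).restrict D).comp
      ((generatedFamily M r.obj).obj ((evalFamily M r.obj r.incl).obj A)) ≅ A :=
  ((ran M).act.obj r.proj).mapIso ((evalGeneratedIso M r.obj r.incl).app A) ≪≫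
    (r.actIso (ran M)).app A

theorem isEquivalence_ranCounit_app (M : CatRep (FullSub D) S) (l : FullSub D) :
    ((ranCounit M).app l).IsEquivalence :=
  (CategoryTheory.Equivalence.mk _ (generatedFamily M l)
    ((evalGeneratedIso M l (𝟙 l.1) ≪≫ (ran M).actId l.1).symm)
    (NatIso.ofComponents (fun X => (M.actId l).app X)
      (fun f => M.actId_naturality l f))).isEquivalence_functor

/-- At the objects of `D`, the unit sends an object to the family it generates. -/
def ranUnitGeneratedIso (N : CatRep C T) (l : FullSub D) :
    (ranUnit D N).app l.1 ≅ generatedFamily (N.restrict D) l :=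
  NatIso.ofComponents
    (fun X => CatTrans.isoMk
      (fun m => NatIso.ofComponents (fun G => Iso.refl _) (fun f => by simp))
      (fun F G => by
        have h := congr($((N.restrict D).act.map_id (InducedBicategory.mkHom (G ≫ F.hom))).app X)
        dsimp at h
        simp [h]))
    (fun f => by ext; simp)

theorem isEquivalence_ranUnit_app (N : CatRep C T) {i : C} (r : RetractOf D i) :
    ((ranUnit D N).app i).IsEquivalence :=
  have e : (evalFamily (N.restrict D) r.obj r.incl ⋙ N.act.obj r.proj) ⋙
      (ranUnit D N).app i ≅ 𝟭 _ :=
    Functor.associator _ _ _ ≪≫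
      Functor.isoWhiskerLeft _ ((ranUnit D N).nat r.proj ≪≫
        Functor.isoWhiskerRight (ranUnitGeneratedIso N r.obj) _) ≪≫
      (Functor.associator _ _ _).symm ≪≫
      Functor.isoWhiskerRight (evalGeneratedIso _ _ _) _ ≪≫
      r.actIso (ran (N.restrict D))
  (CategoryTheory.Equivalence.mk _ (evalFamily (N.restrict D) r.obj r.incl ⋙ N.act.obj r.proj)
    (r.actIso N).symm e).isEquivalence_functor

end Families

section Families

variable {C : Type u} [Bicategory.{w, v} C] {D : Set C}

section

variable {S : FullSub D → Type a₁} [∀ l, Category.{b₁} (S l)]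
  {T : FullSub D → Type a₂} [∀ l, Category.{b₂} (T l)]

/-- `ranMap` as a functor on transformations and modifications. -/
abbrev ranFunctor (M : CatRep (FullSub D) S) (N : CatRep (FullSub D) T) :
    CatTrans M N ⥤ CatTrans (ran M) (ran N) where
  obj Λ := ranMap Λ
  map {Λ Θ} Γ :=
    { app := fun i =>
        { app := fun A =>
            { app := fun l => Functor.whiskerLeft (A.app l) (Γ.app l)
              nat := fun F G => by
                have h := (Γ.app _).naturality ((A.nat F).hom.app G)
                dsimp at h
                simp [← Γ.nat, reassoc_of% h] }
          naturality := fun A B f => by ext; simp }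
      nat := fun F A => by ext; simp }

end

variable {S : C → Type a₁} [∀ i, Category.{b₁} (S i)]
  {T : FullSub D → Type a₂} [∀ l, Category.{b₂} (T l)] {U : C → Type a₃} [∀ i, Category.{b₃} (U i)]

/-- Transposition of a transformation out of a restriction to `D` into one to the extension. -/
abbrev ranTranspose (M : CatRep C S) (P : CatRep (FullSub D) T) :
    CatTrans (M.restrict D) P ⥤ CatTrans M (ran P) :=
  ranFunctor (M.restrict D) P ⋙ CatTrans.precomp (ranUnit D M) (ran P)

/-- The transpose of the restriction of `Λ : M ⟶ N` is the composite of `Λ` with the unit of `N`. -/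
def restrictionTransposeIso (M : CatRep C S) (N : CatRep C U) :
    CatTrans.restriction M N D ⋙ ranTranspose M (N.restrict D) ≅
      CatTrans.postcomp M (ranUnit D N) :=
  NatIso.ofComponents
    (fun Λ => CatTrans.isoMk
      (fun i => NatIso.ofComponents
        (fun X => CatTrans.isoMk
          (fun l => NatIso.ofComponents (fun G => (Λ.nat G).app X)
            (fun α => by simp [Λ.nat_act]))
          (fun F G => by
            have h := Λ.nat_comp G F.hom X
            dsimp at h
            simp [h]))
        (fun f => by ext; simp [Λ.nat_naturality]))
      (fun F X => by
        ext l G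
        have h := Λ.nat_comp F G X
        dsimp at h
        rw [← cancel_epi ((Λ.app _).map ((M.actComp F G).hom.app X)),
          ← cancel_mono ((N.actComp F G).hom.app ((Λ.app _).obj X))]
        simp [h, ← Functor.map_comp_assoc, -Functor.map_comp]))
    (fun Γ => by ext i X l G; simp [Γ.nat])

/-- A transformation is recovered from its transpose by restricting and composing with the
counit. -/
def transposeRestrictionIso (M : CatRep C S) (P : CatRep (FullSub D) T) :
    ranTranspose M P ⋙ CatTrans.restriction M (ran P) D ⋙
        CatTrans.postcomp (M.restrict D) (ranCounit P) ≅
      𝟭 (CatTrans (M.restrict D) P) :=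
  NatIso.ofComponents
    (fun Λ => CatTrans.isoMk
      (fun l => NatIso.ofComponents (fun X => (Λ.app l).mapIso ((M.actId l.1).app X))
        (fun f => by
          have h := congrArg (Λ.app l).map (M.actId_naturality l.1 f)
          simp only [Functor.map_comp] at h
          exact h))
      (fun F X => by
        have hΛ := Λ.nat_naturality F ((M.actId _).hom.app X)
        have hl := congr($((M.act.mapIso (λ_ F.hom)).inv_hom_id).app X)
        replace hl := congrArg (Λ.app _).map hl
        dsimp at hΛ hl
        rw [M.act_leftUnitor] at hl
        simp only [Functor.map_comp, CategoryTheory.Functor.map_id] at hl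
        simp [M.act_rightUnitor, ← hΛ, reassoc_of% hl]))
    (fun Γ => by ext l X; simp)

theorem isEquivalence_restriction (M : CatRep C S) (N : CatRep C U)
    (hD : ∀ i, Nonempty (RetractOf D i)) : (CatTrans.restriction M N D).IsEquivalence := by
  have (i : C) := isEquivalence_ranUnit_app N (hD i).some
  have := CatTrans.isEquivalence_postcomp M (ranUnit D N)
  have : (CatTrans.restriction M N D ⋙ ranTranspose M (N.restrict D)).IsEquivalence :=
    Functor.isEquivalence_of_iso (restrictionTransposeIso M N).symm
  have : (ranTranspose M (N.restrict D) ⋙ CatTrans.restriction M (ran (N.restrict D)) D ⋙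
      CatTrans.postcomp (M.restrict D) (ranCounit (N.restrict D))).IsEquivalence :=
    Functor.isEquivalence_of_iso (transposeRestrictionIso M (N.restrict D)).symm
  exact isEquivalence_of_two_out_of_six _ (ranTranspose M (N.restrict D))
    (CatTrans.restriction M (ran (N.restrict D)) D ⋙
      CatTrans.postcomp (M.restrict D) (ranCounit (N.restrict D)))

end Families

/-! ### Linearity and transport -/

section LinearStructure

variable {B : Type u} [Bicategory.{w₁, v} B] {S : B → Type a₁} [∀ i, Category.{b₁} (S i)]
  {T : B → Type a₂} [∀ i, Category.{b₂} (T i)] [∀ i, Preadditive (T i)]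
  {M : CatRep B S} {N : CatRep B T}

namespace CatTrans

section Preadditive

variable [∀ {i j : B} (F : i ⟶ j), (N.act.obj F).Additive]

section

variable (Λ Θ : CatTrans M N)

instance : Zero (Λ ⟶ Θ) where
  zero := { app := fun i => 0, nat := fun F X => by simp }

instance : Add (Λ ⟶ Θ) where
  add Γ Γ' := { app := fun i => Γ.app i + Γ'.app i, nat := fun F X => by simp [Γ.nat, Γ'.nat] }

instance : Neg (Λ ⟶ Θ) where
  neg Γ := { app := fun i => -Γ.app i, nat := fun F X => by simp [Γ.nat] }

instance : AddCommGroup (Λ ⟶ Θ) where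
  nsmul := nsmulRec
  zsmul := zsmulRec
  add_assoc _ _ _ := hom_ext fun _ _ => add_assoc _ _ _
  zero_add _ := hom_ext fun _ _ => zero_add _
  add_zero _ := hom_ext fun _ _ => add_zero _
  add_comm _ _ := hom_ext fun _ _ => add_comm _ _
  neg_add_cancel _ := hom_ext fun _ _ => neg_add_cancel _

end

instance : Preadditive (CatTrans M N) where
  add_comp _ _ _ _ _ _ := hom_ext fun _ _ => Preadditive.add_comp _ _ _ _ _ _
  comp_add _ _ _ _ _ _ := hom_ext fun _ _ => Preadditive.comp_add _ _ _ _ _ _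

end Preadditive

variable {k : Type w} [Field k] [∀ i, Linear k (T i)]
  [∀ {i j : B} (F : i ⟶ j), (N.act.obj F).Additive]
  [∀ {i j : B} (F : i ⟶ j), (N.act.obj F).Linear k]

instance (Λ Θ : CatTrans M N) : Module k (Λ ⟶ Θ) where
  smul r Γ :=
    { app := fun i => r • Γ.app i
      nat := fun F X => by simp [Γ.nat] }
  one_smul _ := hom_ext fun _ _ => one_smul k _
  mul_smul _ _ _ := hom_ext fun _ _ => mul_smul _ _ _
  smul_zero _ := hom_ext fun _ _ => smul_zero _
  smul_add _ _ _ := hom_ext fun _ _ => smul_add _ _ _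
  add_smul _ _ _ := hom_ext fun _ _ => add_smul _ _ _
  zero_smul _ := hom_ext fun _ _ => zero_smul k _

instance : Linear k (CatTrans M N) where
  smul_comp _ _ _ _ _ _ := hom_ext fun _ _ => Linear.smul_comp _ _ _ _ _ _
  comp_smul _ _ _ _ _ _ := hom_ext fun _ _ => Linear.comp_smul _ _ _ _ _ _

theorem isLinearFunctor_precomp {U : B → Type a₃} [∀ i, Category.{b₃} (U i)] {P : CatRep B U}
    (Λ : CatTrans P M) : IsLinearFunctor k _ _ (precomp Λ N) :=
  ⟨⟨rfl⟩, ⟨fun _ _ => rfl⟩⟩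

end CatTrans

theorem isLinearFunctor_coreprTransFunctor {k : Type w} [Field k] [∀ i, Linear k (T i)]
    [∀ {i j : B} (F : i ⟶ j), (N.act.obj F).Additive]
    [∀ {i j : B} (F : i ⟶ j), (N.act.obj F).Linear k] (i : B) :
    IsLinearFunctor k _ _ (coreprTransFunctor N i) :=
  ⟨⟨CatTrans.hom_ext fun _ G => (N.act.obj G).map_add⟩,
    ⟨fun f r => CatTrans.hom_ext fun _ G => (N.act.obj G).map_smul r f⟩⟩

theorem isLinearFunctor_evalFamily {C : Type u} [Bicategory.{w₁, v} C] {D : Set C}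
    {S : FullSub D → Type a₁} [∀ l, Category.{b₁} (S l)] [∀ l, Preadditive (S l)]
    {k : Type w} [Field k] [∀ l, Linear k (S l)] (M : CatRep (FullSub D) S)
    [∀ {l m : FullSub D} (F : l ⟶ m), (M.act.obj F).Additive]
    [∀ {l m : FullSub D} (F : l ⟶ m), (M.act.obj F).Linear k]
    {i : C} (l : FullSub D) (G : i ⟶ l.1) : IsLinearFunctor k _ _ (evalFamily M l G) :=
  ⟨⟨rfl⟩, ⟨fun _ _ => rfl⟩⟩

end LinearStructure

section Transport

variable {B : Type u} [Bicategory.{w, v} B] {S : B → Type a₁} [∀ i, Category.{b₁} (S i)]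
  {T : B → Type a₂} [∀ i, Category.{b₂} (T i)] (N : CatRep B T) (E : ∀ i, S i ≌ T i)

/-- The homomorphism `N` with its values replaced by equivalent categories. -/
abbrev CatRep.transport : CatRep B S where
  act {i j} :=
    { obj := fun F => (E i).functor ⋙ N.act.obj F ⋙ (E j).inverse
      map := fun α => Functor.whiskerLeft _ (Functor.whiskerRight (N.act.map α) _) }
  actId i :=
    Functor.isoWhiskerLeft (E i).functor (Functor.isoWhiskerRight (N.actId i) (E i).inverse) ≪≫
      (E i).unitIso.symm
  actComp {i j l} F G := NatIso.ofComponents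
    (fun X => (E l).inverse.mapIso ((N.actComp F G).app ((E i).functor.obj X) ≪≫
      (N.act.obj G).mapIso ((E j).counitIso.app ((N.act.obj F).obj ((E i).functor.obj X))).symm))
    (fun f => by simp [← Functor.map_comp])
  act_whiskerLeft F G G' β X := by
    simp [← Functor.map_comp, reassoc_of% N.act_whiskerLeft]
  act_whiskerRight α G X := by
    simp [← Functor.map_comp, reassoc_of% N.act_whiskerRight]
  act_associator {i j l m} F G H X := by
    have hassoc := N.act_associator F G H ((E i).functor.obj X)
    have hnat := N.actComp_naturality G H
      ((E j).counitIso.inv.app ((N.act.obj F).obj ((E i).functor.obj X)))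
    simp [← Functor.map_comp, reassoc_of% hassoc, reassoc_of% hnat]
  act_leftUnitor {i j} F X := by
    have hcounit : (E i).counitIso.inv.app _ ≫ (E i).functor.map
        ((E i).inverse.map ((N.actId i).hom.app ((E i).functor.obj X)) ≫
          (E i).unitIso.inv.app X) = (N.actId i).hom.app ((E i).functor.obj X) := by simp
    simp [← Functor.map_comp, N.act_leftUnitor, hcounit, -Equivalence.fun_inv_map]
  act_rightUnitor {i j} F X := by
    have hnat := N.actId_naturality j
      ((E j).counitIso.inv.app ((N.act.obj F).obj ((E i).functor.obj X)))
    have h := congr((E j).inverse.map $hnat)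
    simp only [Functor.map_comp] at h
    simp [N.act_rightUnitor, reassoc_of% h]

/-- The strong transformation with components the equivalences along which `N` is transported. -/
abbrev CatRep.transportTrans : CatTrans (N.transport E) N where
  app i := (E i).functor
  nat {i j} F := Functor.isoWhiskerLeft ((E i).functor ⋙ N.act.obj F) (E j).counitIso
  nat_act α X := by simp
  nat_id i X := by simp
  nat_comp F G X := by simp

end Transport

/-! ### Finitary 2-representations -/

section Comparison

variable {k : Type w} [Field k]

namespace FinAddCat

theorem congr_app {A B : FinAddCat.{w, v, u} k} {F G : A ⟶ B} {α β : F ⟶ G} (h : α = β)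
    (X : A.carrier) : α.natTrans.app X = β.natTrans.app X := by
  rw [h]

/-- The functor forgetting linearity. -/
@[simps]
def underlying (A B : FinAddCat.{w, v, u} k) : (A ⟶ B) ⥤ A.carrier ⥤ B.carrier where
  obj F := F.functor
  map α := α.natTrans

end FinAddCat

variable {C : Type u} [Bicategory.{w₁, v} C]

namespace CatRep

/-- The category-valued homomorphism underlying a 2-representation. -/
abbrev ofAfmod (M : Afmod.{w, w₁, v, v₂, u, u₂} k C) : CatRep C (fun i => (M.obj i).carrier) where
  act {i j} :=
    { obj := fun F => (M.map F).functor
      map := fun α => (M.map₂ α).natTrans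
      map_id := fun F => congrArg FinAddCat.Hom₂.natTrans (M.map₂_id F)
      map_comp := fun α β => congrArg FinAddCat.Hom₂.natTrans (M.map₂_comp α β) }
  actId i := (FinAddCat.underlying _ _).mapIso (M.mapId i)
  actComp F G := (FinAddCat.underlying _ _).mapIso (M.mapComp F G)
  act_whiskerLeft F G G' β X := by
    have h : M.map₂ (F ◁ β) ≫ (M.mapComp F G').hom =
      (M.mapComp F G).hom ≫ M.map F ◁ M.map₂ β := by simp
    exact FinAddCat.congr_app h X
  act_whiskerRight {i j l F F'} α G X := by
    have h : M.map₂ (α ▷ G) ≫ (M.mapComp F' G).hom =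
      (M.mapComp F G).hom ≫ M.map₂ α ▷ M.map G := by simp
    exact FinAddCat.congr_app h X
  act_associator F G H X := by
    have h : M.map₂ (α_ F G H).hom ≫ (M.mapComp F (G ≫ H)).hom ≫ M.map F ◁ (M.mapComp G H).hom =
      (M.mapComp (F ≫ G) H).hom ≫ (M.mapComp F G).hom ▷ M.map H ≫ (α_ _ _ _).hom := by simp
    exact (FinAddCat.congr_app h X).trans (congrArg _ (Category.comp_id _))
  act_leftUnitor F X := by simp
  act_rightUnitor F X := by simp

/-- The 2-representation given by a category-valued homomorphism with linear functors between
finitary categories. -/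
def toAfmod {S : C → FinAddCat.{w, v₂, u₂} k} (R : CatRep C (fun i => (S i).carrier))
    (hR : ∀ {i j : C} (F : i ⟶ j), IsLinearFunctor k _ _ (R.act.obj F)) :
    Afmod.{w, w₁, v, v₂, u, u₂} k C where
  obj := S
  map F := ⟨R.act.obj F, hR F⟩
  map₂ α := ⟨R.act.map α⟩
  map₂_id F := FinAddCat.Hom₂.ext (R.act.map_id F)
  map₂_comp α β := FinAddCat.Hom₂.ext (R.act.map_comp α β)
  mapId i := FinAddCat.mkIso₂ (R.actId i)
  mapComp F G := FinAddCat.mkIso₂ (R.actComp F G)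
  map₂_whisker_left F G G' β := by ext X; simp [← reassoc_of% R.act_whiskerLeft]
  map₂_whisker_right {i j l F F'} α G := by ext X; simp [← reassoc_of% R.act_whiskerRight]
  map₂_associator F G H := by
    ext X
    have h := R.act_associator F G H X
    simp [← reassoc_of% h]
  map₂_left_unitor F := by ext X; simp [R.act_leftUnitor]
  map₂_right_unitor F := by ext X; simp [R.act_rightUnitor]

end CatRep

namespace CatTrans

variable {M N P : Afmod.{w, w₁, v, v₂, u, u₂} k C}

variable (M N) in
/-- The category-valued transformations and modifications underlying strong transformations of
2-representations and their modifications. -/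
abbrev ofStrongTrans : (M ⟶ N) ⥤ CatTrans (CatRep.ofAfmod M) (CatRep.ofAfmod N) where
  obj Λ :=
    { app := fun i => (Λ.app i).functor
      nat := fun F => (FinAddCat.underlying _ _).mapIso (Λ.naturality F)
      nat_act := fun α X => FinAddCat.congr_app (Λ.naturality_naturality α) X
      nat_id := fun i X => (FinAddCat.congr_app (Λ.naturality_id i) X).trans
        ((congrArg _ (Category.comp_id _)).trans (Category.comp_id _))
      nat_comp := fun F G X => (FinAddCat.congr_app (Λ.naturality_comp F G) X).trans (by
        change _ ≫ 𝟙 _ ≫ _ ≫ 𝟙 _ ≫ _ ≫ 𝟙 _ = _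
        simp only [Category.id_comp, Category.comp_id]
        rfl) }
  map Γ :=
    { app := fun i => (Γ.as.app i).natTrans
      nat := fun F X => FinAddCat.congr_app (Γ.as.naturality F) X }

/-- The strong transformation of 2-representations given by a category-valued transformation with
linear components. -/
def toStrongTrans (Λ : CatTrans (CatRep.ofAfmod M) (CatRep.ofAfmod N))
    (hΛ : ∀ i, IsLinearFunctor k _ _ (Λ.app i)) : M ⟶ N where
  app i := ⟨Λ.app i, hΛ i⟩
  naturality F := FinAddCat.mkIso₂ (Λ.nat F)
  naturality_naturality α := FinAddCat.hom₂_ext (Λ.nat_act α)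
  naturality_id i := by
    ext X
    simpa using Λ.nat_id i X
  naturality_comp F G := by
    ext X
    simpa using Λ.nat_comp F G X

instance : (ofStrongTrans M N).Faithful where
  map_injective {Λ Θ Γ Γ'} h := by
    ext i X
    exact congr(($h).app i |>.app X)

instance : (ofStrongTrans M N).Full where
  map_surjective Γ :=
    ⟨⟨{ app := fun i => ⟨Γ.app i⟩
        naturality := fun F => FinAddCat.hom₂_ext (Γ.nat F) }⟩, rfl⟩

theorem essImage_ofStrongTrans_iff (Λ : CatTrans (CatRep.ofAfmod M) (CatRep.ofAfmod N)) :
    (ofStrongTrans M N).essImage Λ ↔ ∀ i, IsLinearFunctor k _ _ (Λ.app i) where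
  mp := fun ⟨Θ, ⟨e⟩⟩ i => (Θ.app i).property.of_iso (appIso e i)
  mpr hΛ := ⟨toStrongTrans Λ hΛ, ⟨Iso.refl Λ⟩⟩

end CatTrans

end Comparison

section LocalEquivalence

variable {k : Type w} [Field k] {C : Type u} [Bicategory.{w₁, v} C]
  {M N P : Afmod.{w, w₁, v, v₂, u, u₂} k C}

namespace CatTrans

/-- A transformation at a retract of an object of `D` is determined by its component at that
object. -/
def appRetractIso {S : C → Type a₁} [∀ i, Category.{b₁} (S i)] {T : C → Type a₂}
    [∀ i, Category.{b₂} (T i)] {M : CatRep C S} {N : CatRep C T} (Λ : CatTrans M N) {D : Set C}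
    {i : C} (r : RetractOf D i) :
    M.act.obj r.incl ⋙ Λ.app r.obj.1 ⋙ N.act.obj r.proj ≅ Λ.app i :=
  (Functor.associator _ _ _).symm ≪≫ Functor.isoWhiskerRight (Λ.nat r.incl) _ ≪≫
    Functor.associator _ _ _ ≪≫ Functor.isoWhiskerLeft _ (r.actIso N) ≪≫ Functor.rightUnitor _

theorem isLinearFunctor_of_retractOf (Λ : CatTrans (CatRep.ofAfmod M) (CatRep.ofAfmod N))
    {D : Set C} {i : C} (r : RetractOf D i) (hΛ : IsLinearFunctor k _ _ (Λ.app r.obj.1)) :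
    IsLinearFunctor k _ _ (Λ.app i) :=
  ((M.map r.incl).property.comp (hΛ.comp (N.map r.proj).property)).of_iso (Λ.appRetractIso r)

/-- Passage to underlying transformations is compatible with composition. -/
def ofStrongTransCompIso (Λ : M ⟶ N) (Θ : N ⟶ P) :
    (ofStrongTrans M P).obj (Λ ≫ Θ) ≅
      ((ofStrongTrans M N).obj Λ).comp ((ofStrongTrans N P).obj Θ) :=
  isoMk (fun i => Iso.refl _) (fun F X => by
    have h : ((Λ ≫ Θ).naturality F).hom = (α_ _ _ _).inv ≫ (Λ.naturality F).hom ▷ Θ.app _ ≫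
        (α_ _ _ _).hom ≫ Λ.app _ ◁ (Θ.naturality F).hom ≫ (α_ _ _ _).inv :=
      Pseudofunctor.StrongTrans.categoryStruct_comp_naturality_hom Λ Θ F
    have h := FinAddCat.congr_app h X
    simp only [Pseudofunctor.StrongTrans.comp_app, FinAddCat.comp_functor, Functor.comp_obj,
      Pseudofunctor.StrongTrans.categoryStruct_comp_naturality_hom,
      FinAddCat.homCategory_comp_natTrans, FinAddCat.associator_inv_natTrans,
      FinAddCat.whiskerRight_natTrans, FinAddCat.associator_hom_natTrans,
      FinAddCat.whiskerLeft_natTrans, NatTrans.comp_app, Functor.associator_inv_app,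
      Functor.whiskerRight_app, Functor.associator_hom_app, Functor.whiskerLeft_app,
      Category.comp_id, Category.id_comp, Iso.refl_hom, NatTrans.id_app, Iso.trans_hom,
      CategoryTheory.Functor.map_id] at h ⊢
    exact h.symm)

end CatTrans

theorem isEquivalence_mapFunctor_res (M N : Afmod.{w, w₁, v, v₂, u, u₂} k C) {D : Set C}
    (hD : ∀ i, Nonempty (RetractOf D i)) : ((res k D).mapFunctor M N).IsEquivalence :=
  isEquivalence_of_essImage (U := CatTrans.ofStrongTrans M N)
    (V := CatTrans.ofStrongTrans ((res k D).obj M) ((res k D).obj N))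
    (hH' := isEquivalence_restriction (CatRep.ofAfmod M) (CatRep.ofAfmod N) hD) (Iso.refl _)
    (fun Λ hΛ => (CatTrans.essImage_ofStrongTrans_iff Λ).2 fun i =>
      Λ.isLinearFunctor_of_retractOf (hD i).some
        ((CatTrans.essImage_ofStrongTrans_iff _).1 hΛ (hD i).some.obj))

theorem isEquivalence_postcomp_of_isEquivalence_app (M : Afmod.{w, w₁, v, v₂, u, u₂} k C)
    (Θ : N ⟶ P) [∀ i, (Θ.app i).functor.IsEquivalence] :
    (Bicategory.postcomp M Θ).IsEquivalence :=
  isEquivalence_of_essImage (U := CatTrans.ofStrongTrans M N) (V := CatTrans.ofStrongTrans M P)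
    (hH' := CatTrans.isEquivalence_postcomp (CatRep.ofAfmod M) ((CatTrans.ofStrongTrans N P).obj Θ))
    (NatIso.ofComponents (fun Λ => CatTrans.ofStrongTransCompIso Λ Θ)
      (fun Γ => by ext i X; exact (Category.comp_id _).trans (Category.id_comp _).symm))
    (fun Λ hΛ => (CatTrans.essImage_ofStrongTrans_iff Λ).2 fun i => by
      have hΛΘ := (CatTrans.essImage_ofStrongTrans_iff _).1 hΛ i
      have hΘ := IsLinearFunctor.inverse (e := (Θ.app i).functor.asEquivalence) (Θ.app i).property
      exact (hΛΘ.comp hΘ).of_iso (Functor.associator _ _ _ ≪≫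
        Functor.isoWhiskerLeft _ (Θ.app i).functor.asEquivalence.unitIso.symm ≪≫
        Functor.rightUnitor _))

theorem nonempty_equivalence_of_isEquivalence_app (Θ : N ⟶ P)
    [∀ i, (Θ.app i).functor.IsEquivalence] : Nonempty (N ≌ P) :=
  have := isEquivalence_postcomp_of_isEquivalence_app N Θ
  have := isEquivalence_postcomp_of_isEquivalence_app P Θ
  nonempty_equivalence_of_isEquivalence_postcomp Θ

end LocalEquivalence

section LocallyLinear

variable {k : Type w} [Field k] {B : Type u} [Bicategory.{w₁, v} B]
  [∀ i j : B, Preadditive (i ⟶ j)] [∀ i j : B, Linear k (i ⟶ j)]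

/-- A bicategory with `k`-linear categories of morphisms is linear over `k` if horizontal
composition is `k`-bilinear on 2-morphisms. -/
class IsLinearBicategory (k : Type w) [Field k] (B : Type u) [Bicategory.{w₁, v} B]
    [∀ i j : B, Preadditive (i ⟶ j)] [∀ i j : B, Linear k (i ⟶ j)] : Prop where
  whiskerLeft_add {a b c : B} (F : a ⟶ b) {G H : b ⟶ c} (α β : G ⟶ H) :
    F ◁ (α + β) = F ◁ α + F ◁ β
  whiskerLeft_smul {a b c : B} (F : a ⟶ b) {G H : b ⟶ c} (r : k) (α : G ⟶ H) :
    F ◁ (r • α) = r • (F ◁ α)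
  add_whiskerRight {a b c : B} {F G : a ⟶ b} (α β : F ⟶ G) (H : b ⟶ c) :
    (α + β) ▷ H = α ▷ H + β ▷ H
  smul_whiskerRight {a b c : B} {F G : a ⟶ b} (r : k) (α : F ⟶ G) (H : b ⟶ c) :
    (r • α) ▷ H = r • (α ▷ H)

instance [IsFinitaryTwoCategory k B] : IsLinearBicategory k B where
  whiskerLeft_add := IsFinitaryTwoCategory.whiskerLeft_add (k := k)
  whiskerLeft_smul := IsFinitaryTwoCategory.whiskerLeft_smul
  add_whiskerRight := IsFinitaryTwoCategory.add_whiskerRight (k := k)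
  smul_whiskerRight := IsFinitaryTwoCategory.smul_whiskerRight

theorem isLinearFunctor_coreprMap_app [IsLinearBicategory k B] {i j : B} (F : i ⟶ j) (l : B) :
    IsLinearFunctor k _ _ ((coreprMap F).app l) :=
  ⟨⟨fun {_ _ α β} => IsLinearBicategory.whiskerLeft_add k F α β⟩,
    ⟨fun α r => IsLinearBicategory.whiskerLeft_smul F r α⟩⟩

namespace CatRep

variable {S : B → Type a₁} [∀ i, Category.{b₁} (S i)] [∀ i, Preadditive (S i)]
  [∀ i, Linear k (S i)]

variable (k) in
/-- A category-valued homomorphism is locally linear if its actions on categories of morphisms are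
additive and `k`-linear; on 2-representations this is membership in `linearReps`. -/
def IsLocallyLinear (R : CatRep B S) : Prop :=
  ∀ i j : B, IsLinearFunctor k (i ⟶ j) (S i ⥤ S j) R.act

theorem mem_linearReps_iff (M : Afmod.{w, w₁, v, v₂, u, u₂} k B) :
    M ∈ linearReps k B ↔ (ofAfmod M).IsLocallyLinear k where
  mp hM i j := ⟨⟨congrArg FinAddCat.Hom₂.natTrans (hM i j).1.map_add⟩,
    ⟨fun α r => congrArg FinAddCat.Hom₂.natTrans ((hM i j).2.map_smul α r)⟩⟩
  mpr hM i j := ⟨⟨FinAddCat.Hom₂.ext (hM i j).1.map_add⟩,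
    ⟨fun α r => FinAddCat.Hom₂.ext ((hM i j).2.map_smul α r)⟩⟩

theorem IsLocallyLinear.coreprTrans_app {R : CatRep B S} (hR : R.IsLocallyLinear k) {i : B}
    (X : S i) (j : B) : IsLinearFunctor k _ _ ((coreprTrans R X).app j) :=
  ⟨⟨congr(($((hR i j).1.map_add)).app X)⟩,
    ⟨fun α r => congr(($((hR i j).2.map_smul α r)).app X)⟩⟩

theorem IsLocallyLinear.transport {T : B → Type a₂} [∀ i, Category.{b₂} (T i)]
    [∀ i, Preadditive (T i)] [∀ i, Linear k (T i)] {N : CatRep B T} (hN : N.IsLocallyLinear k)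
    {E : ∀ i, S i ≌ T i} (hE : ∀ i, IsLinearFunctor k _ _ (E i).functor) :
    (N.transport E).IsLocallyLinear k := fun i j =>
  have hEj := (hE j).inverse
  ⟨⟨fun {_ _ α β} => by
      ext X
      simp [(hN i j).1.map_add, hEj.1.map_add]⟩,
    ⟨fun α r => by
      ext X
      simp [(hN i j).2.map_smul, hEj.2.map_smul]⟩⟩

end CatRep

variable {C : Type u} [Bicategory.{w₁, v} C] {D : Set C}
  [∀ i j : C, Preadditive (i ⟶ j)] [∀ i j : C, Linear k (i ⟶ j)] [IsLinearBicategory k C]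
  {S : FullSub D → Type a₁} [∀ l, Category.{b₁} (S l)] [∀ l, Preadditive (S l)]
  [∀ l, Linear k (S l)] {M : CatRep (FullSub D) S}

namespace CatRep.IsLocallyLinear

theorem family_app (hM : M.IsLocallyLinear k) {i : C} (r : RetractOf D i) (A : Family D i M)
    (l : FullSub D) : IsLinearFunctor k (i ⟶ l.1) (S l) (A.app l) :=
  have hincl : IsLinearFunctor k _ _ ((coreprIncl r.obj).app l) := ⟨⟨rfl⟩, ⟨fun _ _ => rfl⟩⟩
  ((isLinearFunctor_coreprMap_app r.proj l.1).comp
    (hincl.comp (hM.coreprTrans_app _ l))).of_iso (CatTrans.appIso (r.familyIso A) l)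

theorem ran [∀ {l m : FullSub D} (F : l ⟶ m), (M.act.obj F).Additive]
    [∀ {l m : FullSub D} (F : l ⟶ m), (M.act.obj F).Linear k] (hM : M.IsLocallyLinear k)
    (hD : ∀ i, Nonempty (RetractOf D i)) : (ran M).IsLocallyLinear k := fun i _ =>
  ⟨⟨fun {_ _ α β} => NatTrans.ext (funext fun A => CatTrans.hom_ext fun l G =>
      (congrArg (A.app l).map (IsLinearBicategory.add_whiskerRight k α β G)).trans
        (hM.family_app (hD i).some A l).1.map_add)⟩,
    ⟨fun α r => NatTrans.ext (funext fun A => CatTrans.hom_ext fun l G =>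
      (congrArg (A.app l).map (IsLinearBicategory.smul_whiskerRight r α G)).trans
        ((hM.family_app (hD i).some A l).2.map_smul _ r))⟩⟩

end CatRep.IsLocallyLinear

end LocallyLinear

section EssentialSurjectivity

variable {k : Type w} [Field k]

instance FinAddCat.additive_functor {A B : FinAddCat.{w, v, u} k} (F : A ⟶ B) :
    F.functor.Additive := F.property.1

instance FinAddCat.linear_functor {A B : FinAddCat.{w, v, u} k} (F : A ⟶ B) :
    F.functor.Linear k := F.property.2

variable {C : Type u} [Bicategory.{w₁, v} C] {D : Set C}
  (M : Afmod.{w, w₁, v, v₂, u, u₂} k (FullSub D))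

theorem exists_linear_equivalence_family {i : C} (r : RetractOf D i) :
    ∃ (S : FinAddCat.{w, v₂, u₂} k) (E : S.carrier ≌ Family D i (CatRep.ofAfmod M)),
      IsLinearFunctor k _ _ E.functor := by
  set R := CatRep.ofAfmod M
  have hp : IsLinearFunctor k _ _ (generatedFamily R r.obj ⋙ (ran R).act.obj r.proj) :=
    ((isLinearFunctor_coreprTransFunctor r.obj).comp
      (CatTrans.isLinearFunctor_precomp (coreprIncl r.obj))).comp
      (CatTrans.isLinearFunctor_precomp ((coreprMap r.proj).restrict D))
  have := hp.1
  exact exists_finAddCat_equivalence_of_retract (M.obj r.obj)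
    (isLinearFunctor_evalFamily R r.obj r.incl)
    ((Functor.associator _ _ _).symm ≪≫
      Functor.isoWhiskerRight (evalGeneratedIso R r.obj r.incl) ((ran R).act.obj r.proj) ≪≫
        r.actIso (ran R))

variable {S : C → FinAddCat.{w, v₂, u₂} k}
  (E : ∀ i, (S i).carrier ≌ Family D i (CatRep.ofAfmod M))
  (hE : ∀ i, IsLinearFunctor k _ _ (E i).functor)

/-- The extension to `C` of a 2-representation of a full sub-bicategory, with values in given
finitary models of the categories of families. -/
def extendAfmod : Afmod.{w, w₁, v, v₂, u, u₂} k C :=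
  ((ran (CatRep.ofAfmod M)).transport E).toAfmod fun _ =>
    (hE _).comp ((CatTrans.isLinearFunctor_precomp _).comp (hE _).inverse)

theorem nonempty_equivalence_res_extendAfmod :
    Nonempty ((res k D).obj (extendAfmod M E hE) ≌ M) :=
  let Λ : CatTrans (((ran (CatRep.ofAfmod M)).transport E).restrict D) (CatRep.ofAfmod M) :=
    (((ran (CatRep.ofAfmod M)).transportTrans E).restrict D).comp (ranCounit (CatRep.ofAfmod M))
  have hΛ (l : FullSub D) : (Λ.app l).IsEquivalence :=
    have := isEquivalence_ranCounit_app (CatRep.ofAfmod M) l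
    inferInstance
  let Θ : (res k D).obj (extendAfmod M E hE) ⟶ M :=
    CatTrans.toStrongTrans Λ fun l => (hE l.1).comp (isLinearFunctor_evalFamily _ l _)
  have (l : FullSub D) : (Θ.app l).functor.IsEquivalence := hΛ l
  nonempty_equivalence_of_isEquivalence_app Θ

theorem extendAfmod_mem_linearReps [∀ i j : C, Preadditive (i ⟶ j)]
    [∀ i j : C, Linear k (i ⟶ j)] [IsLinearBicategory k C] (hD : ∀ i, Nonempty (RetractOf D i))
    (hM : M ∈ linearReps k (FullSub D)) : extendAfmod M E hE ∈ linearReps k C :=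
  (CatRep.mem_linearReps_iff _).2 ((((CatRep.mem_linearReps_iff M).1 hM).ran hD).transport hE)

end EssentialSurjectivity

/-! ### Biequivalences -/

section Biequivalences

theorem IsBiequivalence.restrictFull {A : Type u} [Bicategory.{w, v} A] {B : Type u₁}
    [Bicategory.{w₁, v₁} B] {H : A ⥤ᵖ B} (hH : ∀ a a' : A, (H.mapFunctor a a').IsEquivalence)
    {P : Set A} {Q : Set B} (h : ∀ a ∈ P, H.obj a ∈ Q)
    (hs : ∀ b ∈ Q, ∃ a ∈ P, Nonempty (H.obj a ≌ b)) :
    IsBiequivalence (restrictFull H P Q h) where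
  essSurj b := by
    obtain ⟨a, ha, ⟨e⟩⟩ := hs b.1 b.2
    exact ⟨(⟨a, ha⟩ : P), ⟨Bicategory.Equivalence.mkOfAdjointifyCounit
      (f := InducedBicategory.mkHom e.hom) (g := InducedBicategory.mkHom e.inv)
      (InducedBicategory.isoMk e.unit) (InducedBicategory.isoMk e.counit)⟩⟩
  localEquiv a a' :=
    have := hH a.1 a'.1
    { faithful := ⟨fun {F G α β} hαβ => InducedBicategory.hom₂_ext
        ((H.mapFunctor a.1 a'.1).map_injective (congrArg (fun γ => γ.hom) hαβ))⟩
      full := ⟨fun {F G} β =>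
        have ⟨α, hα⟩ := (H.mapFunctor a.1 a'.1).map_surjective β.hom
        ⟨⟨α⟩, InducedBicategory.hom₂_ext hα⟩⟩
      essSurj := ⟨fun F => ⟨InducedBicategory.mkHom ((H.mapFunctor a.1 a'.1).objPreimage F.hom),
        ⟨InducedBicategory.isoMk ((H.mapFunctor a.1 a'.1).objObjPreimageIso F.hom)⟩⟩⟩ }

variable {k : Type w} [Field k] {C : Type u} [Bicategory.{w₁, v} C] {D : Set C}

theorem isBiequivalence_res (hD : ∀ i, Nonempty (RetractOf D i)) :
    IsBiequivalence (res.{w, w₁, v, v₂, u, u₂} k D) where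
  essSurj M := by
    choose S E hE using fun i => exists_linear_equivalence_family M (hD i).some
    exact ⟨extendAfmod M E hE, nonempty_equivalence_res_extendAfmod M E hE⟩
  localEquiv M N := isEquivalence_mapFunctor_res M N hD

theorem isBiequivalence_linearRes [∀ i j : C, Preadditive (i ⟶ j)]
    [∀ i j : C, Linear k (i ⟶ j)] [IsLinearBicategory k C]
    (hD : ∀ i, Nonempty (RetractOf D i)) :
    IsBiequivalence (linearRes.{w, w₁, v, v₂, u, u₂} k D) :=
  IsBiequivalence.restrictFull (fun M N => isEquivalence_mapFunctor_res M N hD) _ fun M hM => by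
    choose S E hE using fun i => exists_linear_equivalence_family M (hD i).some
    exact ⟨extendAfmod M E hE, extendAfmod_mem_linearReps M E hE hD hM,
      nonempty_equivalence_res_extendAfmod M E hE⟩

end Biequivalences

section Maximal

variable {C : Type u} [Bicategory.{w, v} C]

theorem RetractLE.refl (i : C) : RetractLE i i := ⟨𝟙 i, 𝟙 i, ⟨λ_ _⟩⟩

theorem RetractLE.trans {i j l : C} (h : RetractLE i j) (h' : RetractLE j l) : RetractLE i l := by
  obtain ⟨Φ, Ψ, ⟨e⟩⟩ := h
  obtain ⟨Φ', Ψ', ⟨e'⟩⟩ := h'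
  exact ⟨Φ' ≫ Φ, Ψ ≫ Ψ', ⟨α_ _ _ _ ≪≫ whiskerLeftIso Ψ ((α_ _ _ _).symm ≪≫
    whiskerRightIso e' Φ ≪≫ λ_ Φ) ≪≫ e⟩⟩

theorem RetractLE.of_equivalence {i j : C} (e : i ≌ j) : RetractLE i j :=
  ⟨e.inv, e.hom, ⟨e.unit.symm⟩⟩

theorem exists_isRetractMaximal_retractLE {s : Set C} (hs : s.Finite)
    (h : ∀ i : C, ∃ j ∈ s, Nonempty (i ≌ j)) (i : C) :
    ∃ j : C, IsRetractMaximal j ∧ RetractLE i j := by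
  let _ : Preorder C :=
    { le := RetractLE
      le_refl := RetractLE.refl
      le_trans := fun _ _ _ => RetractLE.trans }
  obtain ⟨i', hi', ⟨e⟩⟩ := h i
  obtain ⟨m, hm, hmax⟩ := hs.exists_le_maximal hi'
  refine ⟨m, fun j hj => ?_, (RetractLE.of_equivalence e).trans hm⟩
  obtain ⟨j', hj', ⟨e'⟩⟩ := h j
  exact (RetractLE.of_equivalence e').trans
    (hmax.2 hj' (hj.trans (RetractLE.of_equivalence e')))

theorem IsEssentialChoice.exists_mem_retractLE {D : Set C} (hD : IsEssentialChoice D) {s : Set C}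
    (hs : s.Finite) (h : ∀ i : C, ∃ j ∈ s, Nonempty (i ≌ j)) (i : C) :
    ∃ j ∈ D, RetractLE i j := by
  obtain ⟨m, hm, him⟩ := exists_isRetractMaximal_retractLE hs h i
  obtain ⟨j, hj, ⟨e⟩⟩ := hD.exists_equiv m hm
  exact ⟨j, hj, him.trans (RetractLE.of_equivalence e)⟩

end Maximal

end FinitaryMorita

end

theorem mainTheorem6_general (k : Type w) [Field k] (C : Type u) [Bicategory.{w₁, v} C]
    [∀ i j : C, Preadditive (i ⟶ j)] [∀ i j : C, Linear k (i ⟶ j)]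
    [FinitaryMorita.IsLinearBicategory k C] (D : Set C)
    (hD : ∀ i, ∃ j ∈ D, FinitaryMorita.RetractLE i j) :
    FinitaryMorita.IsBiequivalence (FinitaryMorita.res.{w, w₁, v, v₂, u, u₂} k D) ∧
    FinitaryMorita.IsBiequivalence (FinitaryMorita.linearRes.{w, w₁, v, v₂, u, u₂} k D) :=
  have hr (i : C) : Nonempty (FinitaryMorita.RetractOf D i) := by
    obtain ⟨j, hj, Φ, Ψ, ⟨e⟩⟩ := hD i
    exact ⟨⟨(⟨j, hj⟩ : D), Φ, Ψ, e⟩⟩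
  ⟨FinitaryMorita.isBiequivalence_res hr, FinitaryMorita.isBiequivalence_linearRes hr⟩

theorem mainTheorem6 (k : Type w) [Field k] [IsAlgClosed k]
    (C : Type u) [Bicategory.{w₁, v} C]
    [∀ i j : C, Preadditive (i ⟶ j)] [∀ i j : C, Linear k (i ⟶ j)]
    [FinitaryMorita.IsFinitaryTwoCategory k C]
    (D : Set C) (hD : FinitaryMorita.IsEssentialChoice D) :
    FinitaryMorita.IsBiequivalence (FinitaryMorita.res.{w, w₁, v, v₂, u, u₂} k D) ∧
    FinitaryMorita.IsBiequivalence (FinitaryMorita.linearRes.{w, w₁, v, v₂, u, u₂} k D) := by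
  obtain ⟨s, hs, h⟩ := FinitaryMorita.IsFinitaryTwoCategory.finite_objects (k := k) (C := C)
  exact mainTheorem6_general k C D (hD.exists_mem_retractLE hs h)
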